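/- Let $H=\{(x,y)\in\mathbb R^2 : y\ge 0\}$. Consider five local bifurcations of flows on $H$ in which two singular points on the boundary line merge as the parameter $a$ increases through $0$; they are described by the one-parameter families of vector fields, tangent to $y=0$, 1. (saddle–source) $\{x^2+a,\;y\}$; 2. (saddle–sink) $\{-x^2-a,\;-y\}$; 3. (double saddle) $\{x^2-y^2+a,\;-2xy\}$; 4. (source–sink, an interior sink appears) $\{x^2-y^2+a,\;2xy+ay\}$; 5. (source–sink, an interior source appears) $\{x^2-y^2+a,\;2xy-ay\}$. In each of them, for $-1\le a<0$ the singular points in $H$ are exactly two nondegenerate points of the named types, both on $y=0$; they merge at the origin, the only singular point for $a=0$; and for $0<a\le 1$ there is no singular point in cases 1 and 2, and exactly one in cases 3, 4, 5, which lies in $y>0$ and is a nondegenerate saddle, sink, source respectively. Say that a bifurcation is *realized by gradient flows* if, on a neighbourhood of the origin in $H$ and for small $|a|$, there is a continuous one-parameter family of gradient vector fields (of $C^2$ functions for $C^1$ Riemannian metrics) tangent to $y=0$ that is topologically equivalent, near the origin and $a=0$, to the family above: after an increasing change of the parameter fixing $0$, the flows for corresponding parameters are matched by homeomorphisms that carry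 oriented trajectories to oriented trajectories, have images containing a fixed neighbourhood of the origin, and fix the origin for $a=0$. (i) The first three bifurcations are realized by gradient flows. Explicitly, the Euclidean gradients of the families of functions $$\tfrac{x^3}{3}+ax+\tfrac{y^2}{2},\qquad \tfrac{x^3}{3}+ax-\tfrac{y^2}{2},\qquad \tfrac{x^3}{3}+ax-xy^2$$ realize 1, 2 and 3 respectively; they are topologically equivalent to these families on the whole of $H$ and for all $a$, with homeomorphisms depending continuously on $a$, and have singular points of the same numbers and types as described above. (ii) Bifurcations 4 and 5 cannot be realized by gradient flows, even if the homeomorphisms are not required to depend continuously on $a$. At $a=0$ their flow in $y>0$ consists of loops: every trajectory is defined for all times, is not constant, and tends to the origin both as $t\to+\infty$ and as $t\to-\infty$. Moreover, there is no gradient flow that arises by such a bifurcation from an optimal flow on a compact surface: if $M$ is a compact surface with boundary and $X$ is a gradient field on $M$, tangent to the boundary, with only nondegenerate singular points, exactly one source and exactly one sink, then there is no gradient field $X'$ on $M$, tangent to the boundary, for which there is an open set $U\subset M$ such that $X|_U$ and $X'|_U$ are topologically equivalent to the flows of 4 (or both to those of 5) at $a=-1$ and at $a=1$, respectively, on relatively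 open subsets of $H$ that contain all singular points of these flows, while the singular points of $X$ and of $X'$ outside $U$ correspond bijectively, with the same types. -/

import Mathlib

open Set Filter Topology
open scoped Manifold ContDiff

noncomputable section

namespace BoundaryFlows

/-! ### Topological equivalence of flows, in terms of oriented trajectories -/

/-- `S γ T` says that `γ` restricted to `[0, T]` is a trajectory of a first flow, `S' δ T'` is the
same for a second flow. The map `h` sends every trajectory of the first flow to a trajectory of the
second one, up to an orientation preserving change of time. -/
def MapsTrajectories {P Q : Type*} (S : (ℝ → P) → ℝ → Prop) (S' : (ℝ → Q) → ℝ → Prop)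
    (h : P → Q) : Prop :=
  ∀ (γ : ℝ → P) (T : ℝ), 0 ≤ T → S γ T →
    ∃ (δ : ℝ → Q) (T' : ℝ) (τ : ℝ → ℝ), 0 ≤ T' ∧ S' δ T' ∧
      ContinuousOn τ (Icc 0 T) ∧ StrictMonoOn τ (Icc 0 T) ∧ τ 0 = 0 ∧ τ T = T' ∧
      ∀ t ∈ Icc 0 T, h (γ t) = δ (τ t)

/-- `h`, with inverse `k`, is a homeomorphism from `A` onto `B` that carries the oriented
trajectories of the first flow in `A` to those of the second flow in `B`, and conversely. -/
structure IsOrbitEquiv {P Q : Type*} [TopologicalSpace P] [TopologicalSpace Q]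
    (S : (ℝ → P) → ℝ → Prop) (A : Set P) (S' : (ℝ → Q) → ℝ → Prop) (B : Set Q)
    (h : P → Q) (k : Q → P) : Prop where
  mapsTo : MapsTo h A B
  mapsTo_inv : MapsTo k B A
  invOn : InvOn k h A B
  continuousOn : ContinuousOn h A
  continuousOn_inv : ContinuousOn k B
  map_trajectories : MapsTrajectories S S' h
  map_trajectories_inv : MapsTrajectories S' S k

/-! ### Vector fields on the closed half-plane `y ≥ 0` -/

/-- The closed upper half-plane. -/
def halfPlane : Set (ℝ × ℝ) := {p | 0 ≤ p.2}

/-- The curve `γ` on `[0, T]` is a trajectory of `X` that stays in `A`. -/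
def IsTrajectory (X : ℝ × ℝ → ℝ × ℝ) (A : Set (ℝ × ℝ)) (γ : ℝ → ℝ × ℝ) (T : ℝ) : Prop :=
  ∀ t ∈ Icc 0 T, γ t ∈ A ∧ HasDerivWithinAt γ (X (γ t)) (Icc 0 T) t

/-- The three types of nondegenerate singular points (of gradient fields) in dimension two. -/
inductive SingularKind
  | saddle
  | source
  | sink

/-- The type of a nondegenerate singular point, read off from the linear part `L` of the field in
dimension two: real eigenvalues of opposite signs, both eigenvalues with positive real part, or
both eigenvalues with negative real part. -/
def SingularKind.Holds {E : Type*} [NormedAddCommGroup E] [NormedSpace ℝ E] :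
    SingularKind → (E →L[ℝ] E) → Prop
  | .saddle, L => LinearMap.det (L : E →ₗ[ℝ] E) < 0
  | .source, L => 0 < LinearMap.det (L : E →ₗ[ℝ] E) ∧ 0 < LinearMap.trace ℝ E (L : E →ₗ[ℝ] E)
  | .sink, L => 0 < LinearMap.det (L : E →ₗ[ℝ] E) ∧ LinearMap.trace ℝ E (L : E →ₗ[ℝ] E) < 0

/-- The singular points of a field in the half-plane. -/
def singularPoints (X : ℝ × ℝ → ℝ × ℝ) : Set (ℝ × ℝ) := {p | p ∈ halfPlane ∧ X p = 0}

/-! ### The five local boundary bifurcations -/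

/-- The five local bifurcations in which two singular points on the boundary merge. -/
inductive BoundaryBifurcation
  | saddleSource
  | saddleSink
  | doubleSaddle
  | sourceSinkToSink
  | sourceSinkToSource

/-- The one-parameter families of fields on the half-plane that describe the bifurcations. -/
def BoundaryBifurcation.normalForm : BoundaryBifurcation → ℝ → ℝ × ℝ → ℝ × ℝ
  | .saddleSource, a, p => (p.1 ^ 2 + a, p.2)
  | .saddleSink, a, p => (-p.1 ^ 2 - a, -p.2)
  | .doubleSaddle, a, p => (p.1 ^ 2 - p.2 ^ 2 + a, -2 * p.1 * p.2)
  | .sourceSinkToSink, a, p => (p.1 ^ 2 - p.2 ^ 2 + a, 2 * p.1 * p.2 + a * p.2)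
  | .sourceSinkToSource, a, p => (p.1 ^ 2 - p.2 ^ 2 + a, 2 * p.1 * p.2 - a * p.2)

/-- The types of the two boundary points that merge. -/
def BoundaryBifurcation.before : BoundaryBifurcation → SingularKind × SingularKind
  | .saddleSource => (.saddle, .source)
  | .saddleSink => (.saddle, .sink)
  | .doubleSaddle => (.saddle, .saddle)
  | .sourceSinkToSink => (.source, .sink)
  | .sourceSinkToSource => (.source, .sink)

/-- The type of the interior singular point that appears, if any. -/
def BoundaryBifurcation.after : BoundaryBifurcation → Option SingularKind
  | .saddleSource => none
  | .saddleSink => none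
  | .doubleSaddle => some .saddle
  | .sourceSinkToSink => some .sink
  | .sourceSinkToSource => some .source

/-- The family `X` of fields shows the merging `b`: the boundary line is invariant, for
`-1 ≤ a < 0` there are exactly two singular points, both on the boundary and of the types
prescribed by `b`, at `a = 0` they have merged at the origin, and for `0 < a ≤ 1` there is none, or
exactly one, in the interior and of the type prescribed by `b`. -/
structure ShowsMerging (b : BoundaryBifurcation) (X : ℝ → ℝ × ℝ → ℝ × ℝ) : Prop where
  tangent : ∀ a p, p.2 = 0 → (X a p).2 = 0
  before : ∀ a ∈ Ico (-1 : ℝ) 0, ∃ p q : ℝ × ℝ, p ≠ q ∧ p.2 = 0 ∧ q.2 = 0 ∧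
    singularPoints (X a) = {p, q} ∧
    b.before.1.Holds (fderiv ℝ (X a) p) ∧ b.before.2.Holds (fderiv ℝ (X a) q)
  merged : singularPoints (X 0) = {0}
  after_none : b.after = none → ∀ a ∈ Ioc (0 : ℝ) 1, singularPoints (X a) = ∅
  after_some : ∀ κ, b.after = some κ → ∀ a ∈ Ioc (0 : ℝ) 1, ∃ r : ℝ × ℝ, 0 < r.2 ∧
    singularPoints (X a) = {r} ∧ κ.Holds (fderiv ℝ (X a) r)
  tendsto : ∀ η > 0, ∀ᶠ a in 𝓝 (0 : ℝ), ∀ p ∈ singularPoints (X a), ‖p‖ < η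

/-! ### Gradient families and realizability -/

/-- The gradients of a family of functions with respect to the Euclidean metric `dx² + dy²`. -/
def gradientFamily (F : ℝ → ℝ × ℝ → ℝ) (a : ℝ) (p : ℝ × ℝ) : ℝ × ℝ :=
  (fderiv ℝ (F a) p (1, 0), fderiv ℝ (F a) p (0, 1))

/-- On the part of the half-plane in the open set `U`, and for `|a| < ε`, the fields `X a` form a
continuous family of gradient fields, of functions `f a` with respect to Riemannian metrics `g a`,
which are tangent to the boundary line. -/
def IsGradientFamilyOn (ε : ℝ) (U : Set (ℝ × ℝ)) (X : ℝ → ℝ × ℝ → ℝ × ℝ) : Prop :=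
  ContinuousOn (fun z : ℝ × (ℝ × ℝ) => X z.1 z.2) (Ioo (-ε) ε ×ˢ (U ∩ halfPlane)) ∧
  ∀ a ∈ Ioo (-ε) ε, ∃ (f : ℝ × ℝ → ℝ) (g : ℝ × ℝ → ℝ × ℝ →L[ℝ] ℝ × ℝ →L[ℝ] ℝ),
    ContDiffOn ℝ 2 f (U ∩ halfPlane) ∧ ContDiffOn ℝ 1 g (U ∩ halfPlane) ∧
    (∀ p ∈ U ∩ halfPlane, (∀ v w, g p v w = g p w v) ∧ (∀ v, v ≠ 0 → 0 < g p v v) ∧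
      HasFDerivWithinAt f (g p (X a p)) (U ∩ halfPlane) p) ∧
    ∀ p ∈ U, p.2 = 0 → (X a p).2 = 0

/-- A topological equivalence, near the origin and near the parameter value `0`, of the family `X`
on the part of the half-plane in `U` with the family `Y` on the half-plane: a change `φ` of the
parameter, and for every `a` a homeomorphism `h a` (with inverse `k a`) onto a neighbourhood `V a`
of the origin in the half-plane, carrying trajectories of `X a` to trajectories of `Y (φ a)`. The
sets `V a` do not shrink to the origin. -/
structure IsFamilyEquiv (ε : ℝ) (U : Set (ℝ × ℝ)) (X Y : ℝ → ℝ × ℝ → ℝ × ℝ)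
    (V : ℝ → Set (ℝ × ℝ)) (φ : ℝ → ℝ) (h k : ℝ → ℝ × ℝ → ℝ × ℝ) : Prop where
  continuousOn_param : ContinuousOn φ (Ioo (-ε) ε)
  strictMonoOn_param : StrictMonoOn φ (Ioo (-ε) ε)
  param_zero : φ 0 = 0
  base_point : h 0 0 = 0
  isOpen : ∀ a ∈ Ioo (-ε) ε, IsOpen (V a)
  uniform : ∃ W : Set (ℝ × ℝ), IsOpen W ∧ 0 ∈ W ∧ ∀ a ∈ Ioo (-ε) ε, W ⊆ V a
  orbitEquiv : ∀ a ∈ Ioo (-ε) ε,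
    IsOrbitEquiv (IsTrajectory (X a) (U ∩ halfPlane)) (U ∩ halfPlane)
      (IsTrajectory (Y (φ a)) (V a ∩ halfPlane)) (V a ∩ halfPlane) (h a) (k a)

/-- Topological equivalence of families in which nothing is asked about how the homeomorphisms
depend on the parameter. -/
def WeaklyEquivalent (ε : ℝ) (U : Set (ℝ × ℝ)) (X Y : ℝ → ℝ × ℝ → ℝ × ℝ) : Prop :=
  ∃ V φ h k, IsFamilyEquiv ε U X Y V φ h k

/-- Topological equivalence of families in which the homeomorphisms and their inverses depend
continuously on the parameter. -/
def StronglyEquivalent (ε : ℝ) (U : Set (ℝ × ℝ)) (X Y : ℝ → ℝ × ℝ → ℝ × ℝ) : Prop :=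
  ∃ V φ h k, IsFamilyEquiv ε U X Y V φ h k ∧
    ContinuousOn (fun z : ℝ × (ℝ × ℝ) => h z.1 z.2) (Ioo (-ε) ε ×ˢ (U ∩ halfPlane)) ∧
    ContinuousOn (fun z : ℝ × (ℝ × ℝ) => k z.1 z.2)
      {z | z.1 ∈ Ioo (-ε) ε ∧ z.2 ∈ V z.1 ∩ halfPlane}

/-- The bifurcation `b` can be realized in the space of gradient flows: some family of gradient
fields near a boundary point is topologically equivalent to the family describing `b`. -/
def BoundaryBifurcation.Realizable (b : BoundaryBifurcation) : Prop :=
  ∃ (ε : ℝ) (U : Set (ℝ × ℝ)) (X : ℝ → ℝ × ℝ → ℝ × ℝ), 0 < ε ∧ IsOpen U ∧ 0 ∈ U ∧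
    IsGradientFamilyOn ε U X ∧ WeaklyEquivalent ε U X b.normalForm

/-- The explicit family of functions `F` realizes `b`: its Euclidean gradients are, on the whole
half-plane and for all parameters, a family of gradient fields tangent to the boundary which is
topologically equivalent to the family describing `b`, and they show the same merging. -/
def BoundaryBifurcation.RealizedBy (b : BoundaryBifurcation) (F : ℝ → ℝ × ℝ → ℝ) : Prop :=
  ContDiff ℝ ∞ (fun z : ℝ × (ℝ × ℝ) => F z.1 z.2) ∧
  ShowsMerging b (gradientFamily F) ∧
  ∀ ε > 0, IsGradientFamilyOn ε univ (gradientFamily F) ∧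
    StronglyEquivalent ε univ (gradientFamily F) b.normalForm

/-- The flow of `X` in the open half-plane consists of loops at the origin: every trajectory stays
there for all times and tends to the origin in both directions of time. -/
def ConsistsOfLoops (X : ℝ × ℝ → ℝ × ℝ) : Prop :=
  X 0 = 0 ∧ ∀ p : ℝ × ℝ, 0 < p.2 → X p ≠ 0 ∧ ∃ γ : ℝ → ℝ × ℝ, γ 0 = p ∧
    (∀ t, 0 < (γ t).2 ∧ HasDerivAt γ (X (γ t)) t) ∧
    Tendsto γ atTop (𝓝 0) ∧ Tendsto γ atBot (𝓝 0)

/-! ### Gradient flows on surfaces with boundary -/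

section Surface

variable {M : Type*} [TopologicalSpace M] [ChartedSpace (EuclideanHalfSpace 2) M]

/-- The curve `γ` on `[0, T]` is a trajectory of the field `X` on the surface that stays in `A`. -/
def IsSurfaceTrajectory (X : ∀ p : M, TangentSpace (𝓡∂ 2) p) (A : Set M)
    (γ : ℝ → M) (T : ℝ) : Prop :=
  MapsTo γ (Icc 0 T) A ∧ IsMIntegralCurveOn (I := 𝓡∂ 2) γ X (Icc 0 T)

/-- The field `X` is the gradient of a function for a Riemannian metric on the surface, and is
tangent to the boundary. -/
def IsSurfaceGradient [IsManifold (𝓡∂ 2) ∞ M]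
    (X : ∀ p : M, TangentSpace (𝓡∂ 2) p) : Prop :=
  (∃ (f : M → ℝ) (g : Bundle.ContMDiffRiemannianMetric (𝓡∂ 2) 1 (EuclideanSpace ℝ (Fin 2))
      (fun p : M => TangentSpace (𝓡∂ 2) p)),
    ContMDiff (𝓡∂ 2) 𝓘(ℝ, ℝ) 2 f ∧
    ∀ (p : M) (v : TangentSpace (𝓡∂ 2) p),
      g.inner p (X p) v = mfderiv (𝓡∂ 2) 𝓘(ℝ, ℝ) f p v) ∧
  ∀ p ∈ (𝓡∂ 2).boundary M, WithLp.ofLp (X p) (0 : Fin 2) = (0 : ℝ)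

/-- The linear part of `X` at `p`: the derivative at `p` of the field written in the chart at
`p`. -/
def linearPart (X : ∀ p : M, TangentSpace (𝓡∂ 2) p) (p : M) :
    EuclideanSpace ℝ (Fin 2) →L[ℝ] EuclideanSpace ℝ (Fin 2) :=
  fderivWithin ℝ
    (fun u => (mfderiv (𝓡∂ 2) 𝓘(ℝ, EuclideanSpace ℝ (Fin 2)) (extChartAt (𝓡∂ 2) p)
      ((extChartAt (𝓡∂ 2) p).symm u) (X ((extChartAt (𝓡∂ 2) p).symm u)) :
        EuclideanSpace ℝ (Fin 2)))
    (range (𝓡∂ 2)) (extChartAt (𝓡∂ 2) p p)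

/-- `p` is a nondegenerate singular point of `X` of the given type. -/
def IsSingularOfKind (κ : SingularKind) (X : ∀ p : M, TangentSpace (𝓡∂ 2) p) (p : M) : Prop :=
  X p = 0 ∧ κ.Holds (linearPart X p)

/-- A gradient flow whose singular points are all nondegenerate, with exactly one source and
exactly one sink. Optimal Morse flows have these properties. -/
def IsOptimalGradient [IsManifold (𝓡∂ 2) ∞ M]
    (X : ∀ p : M, TangentSpace (𝓡∂ 2) p) : Prop :=
  IsSurfaceGradient X ∧
  (∀ p, X p = 0 → ∃ κ, IsSingularOfKind κ X p) ∧
  (∃! p, IsSingularOfKind .source X p) ∧ (∃! p, IsSingularOfKind .sink X p)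

/-- The open set `U` of the surface, with the flow of `X` on it, is equivalent to a part of the
half-plane which contains all singular points of `Y`, with the flow of `Y` on it. -/
def LooksLike (X : ∀ p : M, TangentSpace (𝓡∂ 2) p) (U : Set M) (Y : ℝ × ℝ → ℝ × ℝ) : Prop :=
  ∃ (V : Set (ℝ × ℝ)) (h : M → ℝ × ℝ) (k : ℝ × ℝ → M), IsOpen V ∧ singularPoints Y ⊆ V ∧
    IsOrbitEquiv (IsSurfaceTrajectory X U) U
      (IsTrajectory Y (V ∩ halfPlane)) (V ∩ halfPlane) h k

/-- The passage from the flow of `X` to the flow of `X'` is the effect of the bifurcation `b`: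
in an open set `U` the flow changes from the one at `a = -1` to the one at `a = 1` in the family
describing `b`, and the singular points outside `U` correspond to each other, with their types. -/
def IsEffectOf (b : BoundaryBifurcation) (X X' : ∀ p : M, TangentSpace (𝓡∂ 2) p) : Prop :=
  ∃ U : Set M, IsOpen U ∧ LooksLike X U (b.normalForm (-1)) ∧ LooksLike X' U (b.normalForm 1) ∧
    ∃ σ : {p : M // p ∉ U ∧ X p = 0} ≃ {p : M // p ∉ U ∧ X' p = 0},
      ∀ p κ, IsSingularOfKind κ X p.1 ↔ IsSingularOfKind κ X' (σ p).1

end Surface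

end BoundaryFlows

end

open BoundaryFlows

namespace BoundaryFlows

/-! ### The quadratic fields of the plane that leave the boundary line invariant -/

/-! All five normal forms lie in one five-parameter family of quadratic fields, so zeros,
determinants and traces are computed once. The gradients of the cubic potentials lie in the same
family: they equal forms 1 and 3, and become form 2 after `x ↦ -x`. A linear involution therefore
gives the equivalence in part (i).

At `a = 0` forms 4 and 5 are both `z² ∂_z`, with `z = x + iy`, solved by `z / (1 - t z)`. In `y > 0`
these orbits are circles tangent to the boundary line at the origin. An equivalence with a gradient
flow would carry the potential to a function that is nondecreasing along such a loop and has the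
same limit at both ends. That function is constant, so the gradient vanishes along the orbit,
although the orbit is not a point (`not_realizable_of_loops`).

The surface statement is a count of extrema. Topological equivalence preserves monotonicity of the
potential along orbits but not linear parts, so types are recovered in two steps. First, at a point
with a strict Lyapunov function, any continuous function monotone along orbits has a local extremum
(`exists_nhds_le_of_lyapunov`). Second, a nondegenerate zero of a gradient at a local minimum
(maximum) of the potential is a source (sink), since the metric pairing of `L v` with `v` is
semidefinite for the linear part `L` (`inner_linearPart_nonneg`, `det_trace_nonneg`).

In case 4 the region `U` thus contains the only source of `X`. The minimum of the new potential on
the compact surface lies either outside `U`, where it corresponds to a second source of `X`, or in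
`U`, where the only zero is a local maximum; the potential would then be constant near it and the
zero not isolated. Case 5 is the same with signs reversed (`not_isEffectOf_of_extremum_lost`). -/

/-- The fields `(α (x² + a) + β y², (γ x + δ) y)`. -/
def quadraticField (α β γ δ a : ℝ) (p : ℝ × ℝ) : ℝ × ℝ :=
  (α * (p.1 ^ 2 + a) + β * p.2 ^ 2, (γ * p.1 + δ) * p.2)

theorem contDiff_quadraticField (α β γ δ a : ℝ) {n : WithTop ℕ∞} :
    ContDiff ℝ n (quadraticField α β γ δ a) := by
  unfold quadraticField
  fun_prop

theorem normalForm_saddleSource (a : ℝ) :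
    BoundaryBifurcation.saddleSource.normalForm a = quadraticField 1 0 0 1 a := by
  ext p <;> simp [BoundaryBifurcation.normalForm, quadraticField]

theorem normalForm_saddleSink (a : ℝ) :
    BoundaryBifurcation.saddleSink.normalForm a = quadraticField (-1) 0 0 (-1) a := by
  ext p
  · simp [BoundaryBifurcation.normalForm, quadraticField]
    ring
  · simp [BoundaryBifurcation.normalForm, quadraticField]

theorem normalForm_doubleSaddle (a : ℝ) :
    BoundaryBifurcation.doubleSaddle.normalForm a = quadraticField 1 (-1) (-2) 0 a := by
  ext p
  · simp [BoundaryBifurcation.normalForm, quadraticField]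
    ring
  · simp [BoundaryBifurcation.normalForm, quadraticField]

theorem normalForm_sourceSinkToSink (a : ℝ) :
    BoundaryBifurcation.sourceSinkToSink.normalForm a = quadraticField 1 (-1) 2 a a := by
  ext p <;> simp [BoundaryBifurcation.normalForm, quadraticField] <;> ring

theorem normalForm_sourceSinkToSource (a : ℝ) :
    BoundaryBifurcation.sourceSinkToSource.normalForm a = quadraticField 1 (-1) 2 (-a) a := by
  ext p <;> simp [BoundaryBifurcation.normalForm, quadraticField] <;> ring

theorem hasFDerivAt_quadraticField (α β γ δ a : ℝ) (p : ℝ × ℝ) :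
    HasFDerivAt (quadraticField α β γ δ a)
      (((2 * α * p.1) • ContinuousLinearMap.fst ℝ ℝ ℝ +
          (2 * β * p.2) • ContinuousLinearMap.snd ℝ ℝ ℝ).prod
        ((γ * p.2) • ContinuousLinearMap.fst ℝ ℝ ℝ +
          (γ * p.1 + δ) • ContinuousLinearMap.snd ℝ ℝ ℝ)) p := by
  have h1 : HasFDerivAt (fun p : ℝ × ℝ => p.1) (ContinuousLinearMap.fst ℝ ℝ ℝ) p := hasFDerivAt_fst
  have h2 : HasFDerivAt (fun p : ℝ × ℝ => p.2) (ContinuousLinearMap.snd ℝ ℝ ℝ) p := hasFDerivAt_snd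
  unfold quadraticField
  refine HasFDerivAt.prodMk ?_ ?_
  · refine ((((h1.pow 2).add_const a).const_mul α).add ((h2.pow 2).const_mul β)).congr_fderiv ?_
    ext <;> simp <;> ring
  · refine (((h1.const_mul γ).add_const δ).mul h2).congr_fderiv ?_
    ext <;> simp <;> ring

theorem det_prod_eq (L : ℝ × ℝ →L[ℝ] ℝ × ℝ) :
    LinearMap.det (L : ℝ × ℝ →ₗ[ℝ] ℝ × ℝ) =
      (L (1, 0)).1 * (L (0, 1)).2 - (L (0, 1)).1 * (L (1, 0)).2 := by
  rw [← LinearMap.det_toMatrix (Module.Basis.finTwoProd ℝ), Matrix.det_fin_two]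
  simp [LinearMap.toMatrix_apply]

theorem trace_prod_eq (L : ℝ × ℝ →L[ℝ] ℝ × ℝ) :
    LinearMap.trace ℝ (ℝ × ℝ) (L : ℝ × ℝ →ₗ[ℝ] ℝ × ℝ) = (L (1, 0)).1 + (L (0, 1)).2 := by
  rw [LinearMap.trace_eq_matrix_trace ℝ (Module.Basis.finTwoProd ℝ), Matrix.trace_fin_two]
  simp [LinearMap.toMatrix_apply]

theorem det_fderiv_quadraticField (α β γ δ a : ℝ) (p : ℝ × ℝ) :
    LinearMap.det (fderiv ℝ (quadraticField α β γ δ a) p : ℝ × ℝ →ₗ[ℝ] ℝ × ℝ) =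
      2 * α * p.1 * (γ * p.1 + δ) - 2 * β * γ * p.2 ^ 2 := by
  rw [(hasFDerivAt_quadraticField α β γ δ a p).fderiv, det_prod_eq]
  simp
  ring

theorem trace_fderiv_quadraticField (α β γ δ a : ℝ) (p : ℝ × ℝ) :
    LinearMap.trace ℝ (ℝ × ℝ)
      (fderiv ℝ (quadraticField α β γ δ a) p : ℝ × ℝ →ₗ[ℝ] ℝ × ℝ) = 2 * α * p.1 + γ * p.1 + δ := by
  rw [(hasFDerivAt_quadraticField α β γ δ a p).fderiv, trace_prod_eq]
  simp
  ring

theorem mem_singularPoints_quadraticField {α β γ δ a : ℝ} {p : ℝ × ℝ} :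
    p ∈ singularPoints (quadraticField α β γ δ a) ↔
      0 ≤ p.2 ∧ α * (p.1 ^ 2 + a) + β * p.2 ^ 2 = 0 ∧ (γ * p.1 + δ = 0 ∨ p.2 = 0) := by
  simp [singularPoints, halfPlane, quadraticField, Prod.ext_iff]

theorem exists_sq_eq_neg {a : ℝ} (ha : a ∈ Ico (-1 : ℝ) 0) :
    ∃ s : ℝ, 0 < s ∧ s ≤ 1 ∧ a = -s ^ 2 :=
  ⟨√(-a), Real.sqrt_pos.2 (by linarith [ha.2]), Real.sqrt_le_one.2 (by linarith [ha.1]),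
    by rw [Real.sq_sqrt (by linarith [ha.2])]; ring⟩

theorem norm_lt_of_sq_lt {p : ℝ × ℝ} {η : ℝ} (hη : 0 < η) (h1 : p.1 ^ 2 < η ^ 2)
    (h2 : p.2 ^ 2 < η ^ 2) : ‖p‖ < η := by
  rw [Prod.norm_def]
  exact max_lt (abs_lt_of_sq_lt_sq h1 hη.le) (abs_lt_of_sq_lt_sq h2 hη.le)

theorem eventually_abs_lt {η : ℝ} (hη : 0 < η) : ∀ᶠ a : ℝ in 𝓝 0, |a| < η :=
  (continuous_abs.tendsto' 0 0 abs_zero).eventually_lt_const hη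

/-! The fields `(α (x² + a), δ y)`: two boundary points merge and disappear. -/

theorem singularPoints_decoupled {α δ a : ℝ} (hα : α ≠ 0) (hδ : δ ≠ 0) :
    singularPoints (quadraticField α 0 0 δ a) = {p | p.1 ^ 2 + a = 0 ∧ p.2 = 0} := by
  ext p
  rw [mem_singularPoints_quadraticField]
  simp only [zero_mul, zero_add, add_zero, mul_eq_zero, hα, hδ, false_or, mem_ofPred_eq]
  constructor
  · rintro ⟨-, h1, h2⟩
    exact ⟨h1, h2⟩
  · rintro ⟨h1, h2⟩
    exact ⟨h2.ge, h1, h2⟩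

theorem setOf_decoupled_pair {s : ℝ} :
    {p : ℝ × ℝ | p.1 ^ 2 + -s ^ 2 = 0 ∧ p.2 = 0} = {(s, 0), (-s, 0)} := by
  ext ⟨x, y⟩
  simp only [mem_ofPred_eq, mem_insert_iff, mem_singleton_iff, Prod.mk.injEq]
  constructor
  · rintro ⟨h, hy⟩
    have : (x - s) * (x + s) = 0 := by linear_combination h
    rcases mul_eq_zero.1 this with h | h
    · exact Or.inl ⟨by linarith, hy⟩
    · exact Or.inr ⟨by linarith, hy⟩
  · rintro (⟨rfl, rfl⟩ | ⟨rfl, rfl⟩) <;> constructor <;> ring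

theorem showsMerging_decoupled {b : BoundaryBifurcation} {X : ℝ → ℝ × ℝ → ℝ × ℝ} {α δ : ℝ}
    (hX : ∀ a, X a = quadraticField α 0 0 δ a) (hα : α ≠ 0) (hδ : δ ≠ 0) (hb : b.after = none)
    (hk : ∀ s : ℝ, 0 < s → ∃ σ : ℝ, (σ = s ∨ σ = -s) ∧
      b.before.1.Holds (fderiv ℝ (quadraticField α 0 0 δ (-s ^ 2)) (σ, 0)) ∧
      b.before.2.Holds (fderiv ℝ (quadraticField α 0 0 δ (-s ^ 2)) (-σ, 0))) :
    ShowsMerging b X where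
  tangent a p hp := by simp [hX, quadraticField, hp]
  before a ha := by
    obtain ⟨s, hs, -, rfl⟩ := exists_sq_eq_neg ha
    obtain ⟨σ, hσ, h1, h2⟩ := hk s hs
    refine ⟨(σ, 0), (-σ, 0), ?_, rfl, rfl, ?_, by rwa [hX], by rwa [hX]⟩
    · simp only [ne_eq, Prod.mk.injEq, and_true]
      rcases hσ with rfl | rfl <;> intro h <;> linarith
    · rw [hX, singularPoints_decoupled hα hδ, setOf_decoupled_pair]
      rcases hσ with rfl | rfl
      · rfl
      · rw [neg_neg, pair_comm]
  merged := by
    rw [hX, singularPoints_decoupled hα hδ]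
    ext ⟨x, y⟩
    simp
  after_none _ a ha := by
    rw [hX, singularPoints_decoupled hα hδ, eq_empty_iff_forall_notMem]
    rintro p ⟨h, -⟩
    nlinarith [ha.1, sq_nonneg p.1]
  after_some κ h := by simp [hb] at h
  tendsto η hη := by
    filter_upwards [eventually_abs_lt (η := η ^ 2) (by positivity)] with a ha p hp
    rw [hX, singularPoints_decoupled hα hδ] at hp
    have := neg_abs_le a
    exact norm_lt_of_sq_lt hη (by linarith [hp.1]) (by rw [hp.2, zero_pow two_ne_zero]; positivity)

theorem showsMerging_saddleSource :
    ShowsMerging .saddleSource BoundaryBifurcation.saddleSource.normalForm := by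
  refine showsMerging_decoupled normalForm_saddleSource one_ne_zero one_ne_zero rfl
    fun s hs => ⟨-s, Or.inr rfl, ?_, ?_⟩
  · simp only [BoundaryBifurcation.before, SingularKind.Holds, det_fderiv_quadraticField]
    nlinarith
  · simp only [BoundaryBifurcation.before, SingularKind.Holds, det_fderiv_quadraticField,
      trace_fderiv_quadraticField]
    constructor <;> nlinarith

theorem showsMerging_saddleSink :
    ShowsMerging .saddleSink BoundaryBifurcation.saddleSink.normalForm := by
  refine showsMerging_decoupled normalForm_saddleSink (by norm_num) (by norm_num) rfl
    fun s hs => ⟨-s, Or.inr rfl, ?_, ?_⟩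
  · simp only [BoundaryBifurcation.before, SingularKind.Holds, det_fderiv_quadraticField]
    nlinarith
  · simp only [BoundaryBifurcation.before, SingularKind.Holds, det_fderiv_quadraticField,
      trace_fderiv_quadraticField]
    constructor <;> nlinarith

theorem showsMerging_saddleSink_reflected :
    ShowsMerging .saddleSink (fun a => quadraticField 1 0 0 (-1) a) := by
  refine showsMerging_decoupled (fun _ => rfl) (by norm_num) (by norm_num) rfl
    fun s hs => ⟨s, Or.inl rfl, ?_, ?_⟩
  · simp only [BoundaryBifurcation.before, SingularKind.Holds, det_fderiv_quadraticField]
    nlinarith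
  · simp only [BoundaryBifurcation.before, SingularKind.Holds, det_fderiv_quadraticField,
      trace_fderiv_quadraticField]
    constructor <;> nlinarith

/-! The fields `(x² - y² + a, (γ x + c a) y)`: two boundary points merge and move into the
interior. -/

theorem mem_singularPoints_coupled {γ c a : ℝ} {p : ℝ × ℝ} :
    p ∈ singularPoints (quadraticField 1 (-1) γ (c * a) a) ↔
      0 ≤ p.2 ∧ p.1 ^ 2 - p.2 ^ 2 + a = 0 ∧ (γ * p.1 + c * a = 0 ∨ p.2 = 0) := by
  rw [mem_singularPoints_quadraticField]
  refine and_congr_right fun _ => and_congr_left fun _ => ?_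
  constructor <;> intro h <;> linarith

/-- A zero off the boundary line has abscissa of order `a`, so `x²` is negligible against `|a|`; the
sign of `a` then decides whether a height `y` with `y² = x² + a` exists. -/
theorem interior_abscissa {γ c a x : ℝ} (hγ : γ ^ 2 = 4) (h : γ * x + c * a = 0) :
    4 * x ^ 2 = c ^ 2 * a ^ 2 := by
  linear_combination (γ * x - c * a) * h - x ^ 2 * hγ

theorem showsMerging_coupled {b : BoundaryBifurcation} {X : ℝ → ℝ × ℝ → ℝ × ℝ} {γ c : ℝ}
    {κ : SingularKind} (hX : ∀ a, X a = quadraticField 1 (-1) γ (c * a) a)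
    (hγ : γ ^ 2 = 4) (hc : c ^ 2 ≤ 1) (hb : b.after = some κ)
    (hk : ∀ s : ℝ, 0 < s → s ≤ 1 →
      b.before.1.Holds (fderiv ℝ (quadraticField 1 (-1) γ (c * -s ^ 2) (-s ^ 2)) (s, 0)) ∧
      b.before.2.Holds (fderiv ℝ (quadraticField 1 (-1) γ (c * -s ^ 2) (-s ^ 2)) (-s, 0)))
    (hκ : ∀ (a : ℝ) (r : ℝ × ℝ), 0 < a → 0 < r.2 → γ * r.1 = -c * a →
      κ.Holds (fderiv ℝ (quadraticField 1 (-1) γ (c * a) a) r)) :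
    ShowsMerging b X where
  tangent a p hp := by simp [hX, quadraticField, hp]
  before a ha := by
    obtain ⟨s, hs, hs1, rfl⟩ := exists_sq_eq_neg ha
    obtain ⟨h1, h2⟩ := hk s hs hs1
    refine ⟨(s, 0), (-s, 0), ?_, rfl, rfl, ?_, by rwa [hX], by rwa [hX]⟩
    · simp only [ne_eq, Prod.mk.injEq, and_true]
      intro h; linarith
    · rw [← setOf_decoupled_pair, hX]
      ext ⟨x, y⟩
      simp only [mem_singularPoints_coupled, mem_ofPred_eq]
      constructor
      · rintro ⟨h0, h1, h2 | rfl⟩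
        · have h3 := interior_abscissa hγ h2
          -- An off-axis zero would need `y² = x² - s² ≥ 0`, which this bound excludes.
          have h4 : 4 * x ^ 2 ≤ s ^ 2 := by
            rw [h3]
            have : s ^ 2 * s ^ 2 ≤ 1 * s ^ 2 := by gcongr; nlinarith
            nlinarith [mul_le_mul_of_nonneg_right hc (sq_nonneg (s ^ 2))]
          nlinarith [sq_nonneg y, sq_nonneg x]
        · exact ⟨by linarith, rfl⟩
      · rintro ⟨h1, rfl⟩
        exact ⟨le_rfl, by linarith, Or.inr rfl⟩
  merged := by
    rw [hX]
    ext ⟨x, y⟩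
    simp only [mem_singularPoints_coupled, mem_singleton_iff, Prod.mk_eq_zero]
    constructor
    · rintro ⟨h0, h1, h2 | rfl⟩
      · have h3 := interior_abscissa hγ h2
        have h4 : x ^ 2 = 0 := by linarith
        exact ⟨by simpa using h4, by simpa [h4] using h1⟩
      · simpa using h1
    · rintro ⟨rfl, rfl⟩
      simp
  after_none h := by simp [hb] at h
  after_some κ' h a ha := by
    obtain rfl : κ = κ' := by simpa [hb] using h
    have hγ0 : γ ≠ 0 := by rintro rfl; norm_num at hγ
    have hx : γ * (-c * a / γ) = -c * a := mul_div_cancel₀ _ hγ0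
    have hpos : 0 < (-c * a / γ) ^ 2 + a := by nlinarith [ha.1, sq_nonneg (-c * a / γ)]
    refine ⟨(-c * a / γ, √((-c * a / γ) ^ 2 + a)), Real.sqrt_pos.2 hpos, ?_, ?_⟩
    · rw [hX]
      ext ⟨x, y⟩
      simp only [mem_singularPoints_coupled, mem_singleton_iff, Prod.mk.injEq]
      constructor
      · rintro ⟨h0, h1, h2 | rfl⟩
        · obtain rfl : x = -c * a / γ := by
            rw [eq_div_iff hγ0]; linarith
          exact ⟨rfl, by rw [← Real.sqrt_sq h0]; congr 1; linarith⟩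
        · nlinarith [ha.1, sq_nonneg x]
      · rintro ⟨rfl, rfl⟩
        refine ⟨Real.sqrt_nonneg _, ?_, Or.inl (by linarith)⟩
        rw [Real.sq_sqrt hpos.le]; ring
    · rw [hX]
      exact hκ a _ ha.1 (Real.sqrt_pos.2 hpos) hx
  tendsto η hη := by
    filter_upwards [eventually_abs_lt (η := η ^ 2 / 2) (by positivity),
      eventually_abs_lt (η := 1) one_pos] with a ha ha1 p hp
    rw [hX, mem_singularPoints_coupled] at hp
    obtain ⟨h0, h1, h2⟩ := hp
    have h3 := neg_abs_le a
    have h4 := le_abs_self a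
    have h5 : 0 < η ^ 2 := by positivity
    rcases h2 with h2 | h2
    · have h6 := interior_abscissa hγ h2
      have h7 : a ^ 2 ≤ |a| := by
        rw [← sq_abs]; nlinarith [abs_nonneg a]
      have h8 : c ^ 2 * a ^ 2 ≤ a ^ 2 := by nlinarith [sq_nonneg a]
      exact norm_lt_of_sq_lt hη (by linarith) (by linarith)
    · rw [h2] at h1
      exact norm_lt_of_sq_lt hη (by linarith) (by rw [h2]; linarith)

theorem showsMerging_doubleSaddle :
    ShowsMerging .doubleSaddle BoundaryBifurcation.doubleSaddle.normalForm := by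
  refine showsMerging_coupled (γ := -2) (c := 0) (κ := .saddle)
    (fun a => by rw [normalForm_doubleSaddle, zero_mul]) (by norm_num) (by norm_num) rfl ?_ ?_
  · intro s hs _
    simp only [BoundaryBifurcation.before, SingularKind.Holds, det_fderiv_quadraticField]
    constructor <;> nlinarith
  · intro a r ha hr hx
    obtain hx : r.1 = 0 := by linarith
    simp only [SingularKind.Holds, det_fderiv_quadraticField, hx]
    nlinarith

theorem showsMerging_sourceSinkToSink :
    ShowsMerging .sourceSinkToSink BoundaryBifurcation.sourceSinkToSink.normalForm := by
  refine showsMerging_coupled (γ := 2) (c := 1) (κ := .sink)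
    (fun a => by rw [normalForm_sourceSinkToSink, one_mul]) (by norm_num) (by norm_num) rfl ?_ ?_
  · intro s hs hs1
    have h2 : 0 < 2 * s + 1 * -s ^ 2 := by nlinarith
    have h3 : 2 * -s + 1 * -s ^ 2 < 0 := by nlinarith
    simp only [BoundaryBifurcation.before, SingularKind.Holds, det_fderiv_quadraticField,
      trace_fderiv_quadraticField]
    exact ⟨⟨by linarith [mul_pos hs h2], by linarith⟩,
      ⟨by linarith [mul_pos hs (neg_pos.2 h3)], by linarith⟩⟩
  · intro a r ha hr hx
    obtain hx : r.1 = -a / 2 := by linarith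
    simp only [SingularKind.Holds, det_fderiv_quadraticField, trace_fderiv_quadraticField, hx]
    constructor <;> nlinarith

theorem showsMerging_sourceSinkToSource :
    ShowsMerging .sourceSinkToSource BoundaryBifurcation.sourceSinkToSource.normalForm := by
  refine showsMerging_coupled (γ := 2) (c := -1) (κ := .source)
    (fun a => by rw [normalForm_sourceSinkToSource, neg_one_mul])
    (by norm_num) (by norm_num) rfl ?_ ?_
  · intro s hs hs1
    have h2 : 0 < 2 * s + -1 * -s ^ 2 := by nlinarith
    have h3 : 2 * -s + -1 * -s ^ 2 < 0 := by nlinarith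
    simp only [BoundaryBifurcation.before, SingularKind.Holds, det_fderiv_quadraticField,
      trace_fderiv_quadraticField]
    exact ⟨⟨by linarith [mul_pos hs h2], by linarith⟩,
      ⟨by linarith [mul_pos hs (neg_pos.2 h3)], by linarith⟩⟩
  · intro a r ha hr hx
    obtain hx : r.1 = a / 2 := by linarith
    simp only [SingularKind.Holds, det_fderiv_quadraticField, trace_fderiv_quadraticField, hx]
    constructor <;> nlinarith

theorem showsMerging_normalForm (b : BoundaryBifurcation) : ShowsMerging b b.normalForm := by
  cases b
  exacts [showsMerging_saddleSource, showsMerging_saddleSink, showsMerging_doubleSaddle,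
    showsMerging_sourceSinkToSink, showsMerging_sourceSinkToSource]

/-! ### Realization by gradients -/

/-- The potentials `x³ / 3 + a x + e x y² + c y²`. -/
noncomputable def cubicPotential (e c a : ℝ) (p : ℝ × ℝ) : ℝ :=
  p.1 ^ 3 / 3 + a * p.1 + e * p.1 * p.2 ^ 2 + c * p.2 ^ 2

theorem contDiff_cubicPotential (e c : ℝ) {n : WithTop ℕ∞} :
    ContDiff ℝ n (fun z : ℝ × (ℝ × ℝ) => cubicPotential e c z.1 z.2) := by
  unfold cubicPotential
  fun_prop

/-- The Euclidean metric on the plane. -/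
noncomputable def euclideanMetric : ℝ × ℝ →L[ℝ] ℝ × ℝ →L[ℝ] ℝ :=
  (ContinuousLinearMap.fst ℝ ℝ ℝ).smulRight (ContinuousLinearMap.fst ℝ ℝ ℝ) +
    (ContinuousLinearMap.snd ℝ ℝ ℝ).smulRight (ContinuousLinearMap.snd ℝ ℝ ℝ)

theorem euclideanMetric_apply (v w : ℝ × ℝ) :
    euclideanMetric v w = v.1 * w.1 + v.2 * w.2 := by
  simp [euclideanMetric]

theorem hasFDerivAt_cubicPotential (e c a : ℝ) (p : ℝ × ℝ) :
    HasFDerivAt (cubicPotential e c a)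
      (euclideanMetric (quadraticField 1 e (2 * e) (2 * c) a p)) p := by
  have h1 : HasFDerivAt (fun p : ℝ × ℝ => p.1) (ContinuousLinearMap.fst ℝ ℝ ℝ) p := hasFDerivAt_fst
  have h2 : HasFDerivAt (fun p : ℝ × ℝ => p.2) (ContinuousLinearMap.snd ℝ ℝ ℝ) p := hasFDerivAt_snd
  unfold cubicPotential
  simp only [div_eq_mul_inv]
  refine (((((h1.pow 3).mul_const 3⁻¹).add (h1.const_mul a)).add
    ((h1.const_mul e).mul (h2.pow 2))).add ((h2.pow 2).const_mul c)).congr_fderiv ?_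
  ext <;> simp [euclideanMetric_apply, quadraticField] <;> ring

theorem gradientFamily_cubicPotential (e c a : ℝ) :
    gradientFamily (cubicPotential e c) a = quadraticField 1 e (2 * e) (2 * c) a := by
  ext p <;> simp [gradientFamily, (hasFDerivAt_cubicPotential e c a p).fderiv,
    euclideanMetric_apply]

theorem isGradientFamilyOn_cubicPotential (e c ε : ℝ) :
    IsGradientFamilyOn ε univ (gradientFamily (cubicPotential e c)) := by
  refine ⟨?_, fun a _ => ⟨cubicPotential e c a, fun _ => euclideanMetric, ?_, contDiffOn_const,
    fun p _ => ⟨fun v w => ?_, fun v hv => ?_, ?_⟩, fun p _ hp => ?_⟩⟩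
  · simp only [gradientFamily_cubicPotential, quadraticField]
    fun_prop
  · exact ((contDiff_cubicPotential e c).comp (contDiff_prodMk_right a)).contDiffOn
  · simp only [euclideanMetric_apply]
    ring
  · rw [euclideanMetric_apply]
    by_contra! h
    have h1 : v.1 = 0 := by nlinarith [mul_self_nonneg v.1, mul_self_nonneg v.2]
    have h2 : v.2 = 0 := by nlinarith [mul_self_nonneg v.1, mul_self_nonneg v.2]
    exact hv (Prod.ext h1 h2)
  · rw [gradientFamily_cubicPotential]
    exact (hasFDerivAt_cubicPotential e c a p).hasFDerivWithinAt
  · simp [gradientFamily_cubicPotential, quadraticField, hp]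

/-- A linear conjugacy maps solutions to solutions without any change of time. -/
theorem mapsTrajectories_of_conj {X Y : ℝ × ℝ → ℝ × ℝ} {A : Set (ℝ × ℝ)}
    (R : ℝ × ℝ →L[ℝ] ℝ × ℝ) (hA : MapsTo R A A) (hR : ∀ p, R (X p) = Y (R p)) :
    MapsTrajectories (IsTrajectory X A) (IsTrajectory Y A) R := by
  refine fun γ T hT h => ⟨fun t => R (γ t), T, id, hT, fun t ht => ⟨hA (h t ht).1, ?_⟩,
    continuousOn_id, strictMonoOn_id, rfl, rfl, fun t _ => rfl⟩
  rw [← hR]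
  exact R.hasFDerivAt.comp_hasDerivWithinAt t (h t ht).2

theorem stronglyEquivalent_of_conj {X Y : ℝ → ℝ × ℝ → ℝ × ℝ} (R : ℝ × ℝ →L[ℝ] ℝ × ℝ)
    (hinv : ∀ p, R (R p) = p) (hH : MapsTo R halfPlane halfPlane)
    (hR : ∀ a p, R (X a p) = Y a (R p)) (ε : ℝ) : StronglyEquivalent ε univ X Y := by
  have hR' : ∀ a p, R (Y a p) = X a (R p) := fun a p => by
    rw [← hinv (X a (R p)), hR, hinv]
  have hH' : MapsTo R (univ ∩ halfPlane) (univ ∩ halfPlane) := by simpa using hH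
  refine ⟨fun _ => univ, id, fun _ => R, fun _ => R,
    { continuousOn_param := continuousOn_id
      strictMonoOn_param := strictMonoOn_id
      param_zero := rfl
      base_point := map_zero R
      isOpen := fun _ _ => isOpen_univ
      uniform := ⟨univ, isOpen_univ, trivial, fun _ _ => subset_rfl⟩
      orbitEquiv := fun a _ =>
        { mapsTo := hH'
          mapsTo_inv := hH'
          invOn := ⟨fun p _ => hinv p, fun p _ => hinv p⟩
          continuousOn := R.continuous.continuousOn
          continuousOn_inv := R.continuous.continuousOn
          map_trajectories := mapsTrajectories_of_conj R hH' (hR a)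
          map_trajectories_inv := mapsTrajectories_of_conj R hH' (hR' a) } }, ?_, ?_⟩
  · exact (R.continuous.comp continuous_snd).continuousOn
  · exact (R.continuous.comp continuous_snd).continuousOn

theorem realizedBy_cubicPotential {b : BoundaryBifurcation} {e c : ℝ} (R : ℝ × ℝ →L[ℝ] ℝ × ℝ)
    (hinv : ∀ p, R (R p) = p) (hH : MapsTo R halfPlane halfPlane)
    (hR : ∀ a p, R (quadraticField 1 e (2 * e) (2 * c) a p) = b.normalForm a (R p))
    (hm : ShowsMerging b (fun a => quadraticField 1 e (2 * e) (2 * c) a)) :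
    b.RealizedBy (cubicPotential e c) := by
  refine ⟨contDiff_cubicPotential e c, ?_, fun ε _ => ⟨isGradientFamilyOn_cubicPotential e c ε,
    stronglyEquivalent_of_conj R hinv hH (fun a p => ?_) ε⟩⟩
  · rwa [funext (gradientFamily_cubicPotential e c)]
  · rw [gradientFamily_cubicPotential, hR]

theorem saddleSource_realizedBy : BoundaryBifurcation.saddleSource.RealizedBy
    (fun a p => p.1 ^ 3 / 3 + a * p.1 + p.2 ^ 2 / 2) := by
  have h : (fun (a : ℝ) (p : ℝ × ℝ) => p.1 ^ 3 / 3 + a * p.1 + p.2 ^ 2 / 2) =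
      cubicPotential 0 (1 / 2) := by
    funext a p
    simp only [cubicPotential]
    ring
  have h2 : ∀ a, quadraticField 1 0 (2 * 0) (2 * (1 / 2)) a =
      BoundaryBifurcation.saddleSource.normalForm a := fun a => by
    rw [normalForm_saddleSource]; norm_num
  rw [h]
  refine realizedBy_cubicPotential (.id ℝ _) (fun _ => rfl) (fun _ hp => hp) (fun a p => ?_) ?_
  · rw [h2]; rfl
  · rw [funext h2]
    exact showsMerging_saddleSource

theorem saddleSink_realizedBy : BoundaryBifurcation.saddleSink.RealizedBy
    (fun a p => p.1 ^ 3 / 3 + a * p.1 - p.2 ^ 2 / 2) := by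
  have h : (fun (a : ℝ) (p : ℝ × ℝ) => p.1 ^ 3 / 3 + a * p.1 - p.2 ^ 2 / 2) =
      cubicPotential 0 (-(1 / 2)) := by
    funext a p
    simp only [cubicPotential]
    ring
  rw [h]
  -- The gradient is `(x² + a, -y)`; reflecting `x` turns it into `(-x² - a, -y)`.
  refine realizedBy_cubicPotential
    ((-ContinuousLinearMap.fst ℝ ℝ ℝ).prod (ContinuousLinearMap.snd ℝ ℝ ℝ))
    (fun p => by ext <;> simp) (fun _ hp => hp) (fun a p => ?_) ?_
  · ext <;> simp [quadraticField, BoundaryBifurcation.normalForm]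
    ring
  · convert showsMerging_saddleSink_reflected using 3 <;> norm_num

theorem doubleSaddle_realizedBy : BoundaryBifurcation.doubleSaddle.RealizedBy
    (fun a p => p.1 ^ 3 / 3 + a * p.1 - p.1 * p.2 ^ 2) := by
  have h : (fun (a : ℝ) (p : ℝ × ℝ) => p.1 ^ 3 / 3 + a * p.1 - p.1 * p.2 ^ 2) =
      cubicPotential (-1) 0 := by
    funext a p
    simp only [cubicPotential]
    ring
  have h2 : ∀ a, quadraticField 1 (-1) (2 * -1) (2 * 0) a =
      BoundaryBifurcation.doubleSaddle.normalForm a := fun a => by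
    rw [normalForm_doubleSaddle]; norm_num
  rw [h]
  refine realizedBy_cubicPotential (.id ℝ _) (fun _ => rfl) (fun _ hp => hp) (fun a p => ?_) ?_
  · rw [h2]; rfl
  · rw [funext h2]
    exact showsMerging_doubleSaddle

theorem BoundaryBifurcation.RealizedBy.realizable {b : BoundaryBifurcation}
    {F : ℝ → ℝ × ℝ → ℝ} (h : b.RealizedBy F) : b.Realizable := by
  obtain ⟨hG, V, φ, h, k, hE, -⟩ := h.2.2 1 one_pos
  exact ⟨1, univ, _, one_pos, isOpen_univ, trivial, hG, V, φ, h, k, hE⟩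

/-! ### The flow of loops -/

/-- The trajectory `z / (1 - t z)` of `z² ∂_z`, in real coordinates. -/
noncomputable def loop (p : ℝ × ℝ) (t : ℝ) : ℝ × ℝ :=
  ((p.1 - t * (p.1 ^ 2 + p.2 ^ 2)) / ((1 - t * p.1) ^ 2 + (t * p.2) ^ 2),
    p.2 / ((1 - t * p.1) ^ 2 + (t * p.2) ^ 2))

theorem loop_denominator_pos {p : ℝ × ℝ} (hp : 0 < p.2) (t : ℝ) :
    0 < (1 - t * p.1) ^ 2 + (t * p.2) ^ 2 := by
  rcases eq_or_ne t 0 with rfl | ht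
  · norm_num
  · positivity

theorem loop_zero (p : ℝ × ℝ) : loop p 0 = p := by simp [loop]

theorem loop_snd_pos {p : ℝ × ℝ} (hp : 0 < p.2) (t : ℝ) : 0 < (loop p t).2 :=
  div_pos hp (loop_denominator_pos hp t)

theorem hasDerivAt_loop {p : ℝ × ℝ} (hp : 0 < p.2) (t : ℝ) :
    HasDerivAt (loop p) (quadraticField 1 (-1) 2 0 0 (loop p t)) t := by
  have h0 := (loop_denominator_pos hp t).ne'
  have hd : HasDerivAt (fun t : ℝ => (1 - t * p.1) ^ 2 + (t * p.2) ^ 2)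
      (-2 * p.1 * (1 - t * p.1) + 2 * p.2 * (t * p.2)) t := by
    refine (((((hasDerivAt_id t).mul_const p.1).const_sub 1).pow 2).add
      (((hasDerivAt_id t).mul_const p.2).pow 2)).congr_deriv ?_
    simp
    ring
  have hn : HasDerivAt (fun t : ℝ => p.1 - t * (p.1 ^ 2 + p.2 ^ 2)) (-(p.1 ^ 2 + p.2 ^ 2)) t :=
    (((hasDerivAt_id t).mul_const (p.1 ^ 2 + p.2 ^ 2)).const_sub p.1).congr_deriv (by simp)
  refine HasDerivAt.prodMk ((hn.div hd h0).congr_deriv ?_)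
    (((hasDerivAt_const t p.2).div hd h0).congr_deriv ?_)
  · simp only [loop]
    field_simp
    ring
  · simp only [loop, zero_mul, zero_sub, add_zero]
    field_simp
    ring

/-- In complex terms `|z / (1 - t z)| ≤ |z| / (|t| Im z)`, because `|1 - t z|` is at least the
modulus of its imaginary part. -/
theorem norm_loop_le {p : ℝ × ℝ} (hp : 0 < p.2) {t : ℝ} (ht : t ≠ 0) :
    ‖loop p t‖ ≤ (|p.1| + p.2) / p.2 / |t| := by
  have hD := loop_denominator_pos hp t
  have hC : 0 ≤ (|p.1| + p.2) / p.2 / |t| := by positivity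
  have key : (loop p t).1 ^ 2 + (loop p t).2 ^ 2 ≤ ((|p.1| + p.2) / p.2 / |t|) ^ 2 := by
    have h1 : (loop p t).1 ^ 2 + (loop p t).2 ^ 2 =
        (p.1 ^ 2 + p.2 ^ 2) / ((1 - t * p.1) ^ 2 + (t * p.2) ^ 2) := by
      have := hD.ne'
      simp only [loop]
      field_simp
      ring
    have h2 : ((|p.1| + p.2) / p.2 / |t|) ^ 2 = (|p.1| + p.2) ^ 2 / (t * p.2) ^ 2 := by
      rw [div_div, div_pow, mul_pow, sq_abs, mul_pow, mul_comm]
    rw [h1, h2]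
    gcongr
    · nlinarith [sq_abs p.1, mul_nonneg (abs_nonneg p.1) hp.le]
    · nlinarith [sq_nonneg (1 - t * p.1)]
  rw [Prod.norm_def]
  exact max_le (abs_le_of_sq_le_sq (by nlinarith [sq_nonneg (loop p t).2]) hC)
    (abs_le_of_sq_le_sq (by nlinarith [sq_nonneg (loop p t).1]) hC)

theorem tendsto_loop {p : ℝ × ℝ} (hp : 0 < p.2) {l : Filter ℝ} (hl : Tendsto (|·|) l atTop) :
    Tendsto (loop p) l (𝓝 0) := by
  have h : Tendsto (fun t => (|p.1| + p.2) / p.2 / |t|) l (𝓝 0) :=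
    tendsto_const_nhds.div_atTop hl
  refine squeeze_zero_norm' ?_ h
  filter_upwards [hl.eventually_gt_atTop 0] with t ht
  exact norm_loop_le hp (abs_pos.1 ht)

theorem consistsOfLoops_quadraticField : ConsistsOfLoops (quadraticField 1 (-1) 2 0 0) := by
  refine ⟨by simp [quadraticField], fun p hp => ⟨fun h => ?_, loop p, loop_zero p,
    fun t => ⟨loop_snd_pos hp t, hasDerivAt_loop hp t⟩, tendsto_loop hp tendsto_abs_atTop_atTop,
    tendsto_loop hp tendsto_abs_atBot_atTop⟩⟩
  obtain ⟨h1, h2⟩ := Prod.ext_iff.1 h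
  simp only [quadraticField, Prod.fst_zero, Prod.snd_zero, mul_eq_zero] at h1 h2
  have h3 : p.1 = 0 := by
    rcases h2 with h2 | h2 <;> linarith
  rw [h3] at h1
  nlinarith

/-! ### Functions that increase along trajectories -/

theorem monotoneOn_Icc_of_hasDerivWithinAt_nonneg {u u' : ℝ → ℝ} {T : ℝ}
    (hu : ∀ t ∈ Icc 0 T, HasDerivWithinAt u (u' t) (Icc 0 T) t)
    (h : ∀ t ∈ Icc 0 T, 0 ≤ u' t) : MonotoneOn u (Icc 0 T) :=
  monotoneOn_of_hasDerivWithinAt_nonneg (convex_Icc 0 T)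
    (fun t ht => (hu t ht).continuousWithinAt)
    (fun t ht => (hu t (interior_subset ht)).mono interior_subset)
    (fun t ht => h t (interior_subset ht))

theorem eq_endpoints_of_hasDerivWithinAt_zero {E : Type*} [NormedAddCommGroup E] [NormedSpace ℝ E]
    {γ : ℝ → E} {T : ℝ} (hT : 0 ≤ T)
    (hγ : ∀ t ∈ Icc 0 T, HasDerivWithinAt γ 0 (Icc 0 T) t) : γ 0 = γ T := by
  refine (constant_of_has_deriv_right_zero (fun t ht => (hγ t ht).continuousWithinAt)
    (fun t ht => ?_) T (right_mem_Icc.2 hT)).symm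
  exact (hγ t (Ico_subset_Icc_self ht)).mono_of_mem_nhdsWithin (Icc_mem_nhdsGE_of_mem ht)

section PlanarGradient

variable {X : ℝ × ℝ → ℝ × ℝ} {A : Set (ℝ × ℝ)} {f : ℝ × ℝ → ℝ}
  {g : ℝ × ℝ → ℝ × ℝ →L[ℝ] ℝ × ℝ →L[ℝ] ℝ} {γ : ℝ → ℝ × ℝ} {T : ℝ}

theorem IsTrajectory.hasDerivWithinAt_potential
    (hf : ∀ p ∈ A, HasFDerivWithinAt f (g p (X p)) A p) (hγ : IsTrajectory X A γ T) :
    ∀ t ∈ Icc 0 T, HasDerivWithinAt (f ∘ γ) (g (γ t) (X (γ t)) (X (γ t))) (Icc 0 T) t :=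
  fun t ht => (hf _ (hγ t ht).1).comp_hasDerivWithinAt t (hγ t ht).2 fun s hs => (hγ s hs).1

theorem IsTrajectory.monotoneOn_potential (hg : ∀ p ∈ A, ∀ v, v ≠ 0 → 0 < g p v v)
    (hf : ∀ p ∈ A, HasFDerivWithinAt f (g p (X p)) A p) (hγ : IsTrajectory X A γ T) :
    MonotoneOn (f ∘ γ) (Icc 0 T) := by
  refine monotoneOn_Icc_of_hasDerivWithinAt_nonneg (hγ.hasDerivWithinAt_potential hf) fun t ht => ?_
  rcases eq_or_ne (X (γ t)) 0 with h | h
  · simp [h]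
  · exact (hg _ (hγ t ht).1 _ h).le

/-- A monotone function with equal end values is constant, so `g(X, X) = 0` along the curve;
positivity of `g` gives `X = 0` there, and the curve does not move. -/
theorem IsTrajectory.endpoints_eq_of_potential_eq (hg : ∀ p ∈ A, ∀ v, v ≠ 0 → 0 < g p v v)
    (hf : ∀ p ∈ A, HasFDerivWithinAt f (g p (X p)) A p) (hT : 0 ≤ T) (hγ : IsTrajectory X A γ T)
    (h : f (γ 0) = f (γ T)) : γ 0 = γ T := by
  rcases hT.eq_or_lt with rfl | hT'
  · rfl
  have hm := hγ.monotoneOn_potential hg hf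
  have hc : ∀ t ∈ Icc 0 T, (f ∘ γ) t = f (γ 0) := fun t ht =>
    le_antisymm ((hm ht (right_mem_Icc.2 hT) ht.2).trans_eq h.symm)
      (hm (left_mem_Icc.2 hT) ht ht.1)
  refine eq_endpoints_of_hasDerivWithinAt_zero hT fun t ht => ?_
  have h1 := hγ.hasDerivWithinAt_potential hf t ht
  have h2 : HasDerivWithinAt (f ∘ γ) 0 (Icc 0 T) t :=
    (hasDerivWithinAt_const t (Icc 0 T) (f (γ 0))).congr hc (hc t ht)
  have h3 := (uniqueDiffOn_Icc hT' t ht).eq_deriv _ h1 h2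
  have h4 : X (γ t) = 0 := by
    by_contra h5
    exact (hg _ (hγ t ht).1 _ h5).ne' h3
  simpa [h4] using (hγ t ht).2

end PlanarGradient

theorem IsTrajectory.reverse {X : ℝ × ℝ → ℝ × ℝ} {A : Set (ℝ × ℝ)} {γ : ℝ → ℝ × ℝ} {T : ℝ}
    (h : IsTrajectory (-X) A γ T) : IsTrajectory X A (fun t => γ (T - t)) T := by
  intro t ht
  have ht' : T - t ∈ Icc 0 T := ⟨by linarith [ht.2], by linarith [ht.1]⟩
  refine ⟨(h _ ht').1, ?_⟩
  have hm : MapsTo (fun t => T - t) (Icc 0 T) (Icc 0 T) := fun s hs =>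
    ⟨by linarith [hs.2], by linarith [hs.1]⟩
  simpa using! (h _ ht').2.scomp t (((hasDerivAt_id t).const_sub T).hasDerivWithinAt) hm

/-! ### Fields whose flow consists of loops are not equivalent to gradients -/

/-- The orbit of `iy` lies on the circle with diameter from `0` to `iy`. Hence arbitrarily small
neighbourhoods of the origin contain entire loops. -/
theorem norm_loop_le_height {y : ℝ} (hy : 0 < y) (t : ℝ) : ‖loop (0, y) t‖ ≤ y := by
  have hD : 0 < (1 - t * 0) ^ 2 + (t * y) ^ 2 := loop_denominator_pos (p := (0, y)) hy t
  rw [Prod.norm_def]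
  refine max_le ?_ ?_
  · simp only [loop, Real.norm_eq_abs, abs_div, abs_of_pos hD]
    rw [div_le_iff₀ hD, abs_le]
    constructor <;> nlinarith [mul_nonneg hy.le (sq_nonneg (1 - t * y)),
      mul_nonneg hy.le (sq_nonneg (1 + t * y)), mul_nonneg hy.le (sq_nonneg (t * y))]
  · simp only [loop, Real.norm_eq_abs, abs_div, abs_of_pos hD, abs_of_pos hy]
    rw [div_le_iff₀ hD]
    nlinarith [mul_nonneg hy.le (sq_nonneg (t * y))]

theorem not_realizable_of_loops {b : BoundaryBifurcation}
    (hb : b.normalForm 0 = quadraticField 1 (-1) 2 0 0) : ¬ b.Realizable := by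
  rintro ⟨ε, U, X, hε, hU, h0U, ⟨-, hX⟩, V, φ, h, k, hE⟩
  have hmem : (0 : ℝ) ∈ Ioo (-ε) ε := ⟨by linarith, hε⟩
  obtain ⟨f, g, hf2, -, hfg, -⟩ := hX 0 hmem
  obtain ⟨W, hW, h0W, hWV⟩ := hE.uniform
  have hO := hE.orbitEquiv 0 hmem
  rw [hE.param_zero, hb] at hO
  have hg : ∀ p ∈ U ∩ halfPlane, ∀ v, v ≠ 0 → 0 < g p v v := fun p hp => (hfg p hp).2.1
  have hf : ∀ p ∈ U ∩ halfPlane, HasFDerivWithinAt f (g p (X 0 p)) (U ∩ halfPlane) p :=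
    fun p hp => (hfg p hp).2.2
  obtain ⟨r, hr, hrW⟩ := Metric.isOpen_iff.1 hW 0 h0W
  set p : ℝ × ℝ := (0, r / 2) with hp
  have hp2 : 0 < p.2 := half_pos hr
  have hloop : ∀ t, loop p t ∈ V 0 ∩ halfPlane := fun t => by
    refine ⟨hWV 0 hmem (hrW ?_), (loop_snd_pos hp2 t).le⟩
    rw [mem_ball_zero_iff]
    exact (norm_loop_le_height (half_pos hr) t).trans_lt (half_lt_self hr)
  have htraj : ∀ s T, IsTrajectory (quadraticField 1 (-1) 2 0 0) (V 0 ∩ halfPlane)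
      (fun t => loop p (t + s)) T := fun s T t _ =>
    ⟨hloop _, (((hasDerivAt_loop hp2 (t + s)).comp_add_const t s)).hasDerivWithinAt⟩
  -- Transported to the gradient side, each piece of the loop is a trajectory up to a change of
  -- time, and the potential increases along it.
  have hmono : Monotone fun t => f (k 0 (loop p t)) := by
    intro s t hst
    obtain ⟨δ, T', τ, hT', hδ, -, -, h0, h1, hτ⟩ :=
      hO.map_trajectories_inv _ (t - s) (sub_nonneg.2 hst) (htraj s (t - s))
    have e0 := hτ 0 (left_mem_Icc.2 (sub_nonneg.2 hst))
    have e1 := hτ (t - s) (right_mem_Icc.2 (sub_nonneg.2 hst))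
    simp only [zero_add, sub_add_cancel, h0, h1] at e0 e1
    simp only [e0, e1]
    exact hδ.monotoneOn_potential hg hf (left_mem_Icc.2 hT') (right_mem_Icc.2 hT') hT'
  have h0V : (0 : ℝ × ℝ) ∈ V 0 ∩ halfPlane := ⟨hWV 0 hmem h0W, show (0 : ℝ) ≤ 0 from le_rfl⟩
  have hcont : ContinuousWithinAt (fun p => f (k 0 p)) (V 0 ∩ halfPlane) 0 :=
    ContinuousOn.comp (t := U ∩ halfPlane) hf2.continuousOn hO.continuousOn_inv hO.mapsTo_inv 0 h0V
  have hlim : ∀ l : Filter ℝ, Tendsto (|·|) l atTop →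
      Tendsto (fun t => f (k 0 (loop p t))) l (𝓝 (f (k 0 0))) := fun l hl =>
    hcont.tendsto.comp (tendsto_nhdsWithin_iff.2 ⟨tendsto_loop hp2 hl, .of_forall hloop⟩)
  -- A monotone function lies between its limits at the two ends, and here these coincide.
  have hconst : ∀ t, f (k 0 (loop p t)) = f (k 0 0) := fun t =>
    le_antisymm (hmono.ge_of_tendsto (hlim _ tendsto_abs_atTop_atTop) t)
      (hmono.le_of_tendsto (hlim _ tendsto_abs_atBot_atTop) t)
  obtain ⟨δ, T', τ, hT', hδ, -, -, h0, h1, hτ⟩ :=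
    hO.map_trajectories_inv _ 1 zero_le_one (htraj 0 1)
  have e0 := hτ 0 (left_mem_Icc.2 zero_le_one)
  have e1 := hτ 1 (right_mem_Icc.2 zero_le_one)
  simp only [add_zero, h0, h1] at e0 e1
  have hδe : δ 0 = δ T' :=
    hδ.endpoints_eq_of_potential_eq hg hf hT' (by rw [← e0, ← e1, hconst, hconst])
  have hinj : loop p 0 = loop p 1 :=
    hO.invOn.2.injOn (hloop 0) (hloop 1) (by rw [e0, e1, hδe])
  -- The abscissa is zero at time 0 and negative at time 1.
  have := (Prod.ext_iff.1 hinj).1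
  simp only [loop, hp] at this
  have hD : 0 < (1 - 1 * 0) ^ 2 + (1 * (r / 2)) ^ 2 := by positivity
  rw [eq_comm, div_eq_iff hD.ne'] at this
  norm_num at this
  exact hr.ne' this

/-! ### Local trajectories in the half-plane and Lyapunov functions -/

theorem isClosed_halfPlane : IsClosed halfPlane := isClosed_le continuous_const continuous_snd

/-- At a boundary point the equation is solved on the invariant line, which keeps the solution in
the half-plane; at an interior point continuity keeps it there for a short time. -/
theorem exists_local_trajectory {Y : ℝ × ℝ → ℝ × ℝ} (hY : ContDiff ℝ 1 Y)
    (htan : ∀ p, p.2 = 0 → (Y p).2 = 0) {p : ℝ × ℝ} (hp : p ∈ halfPlane) :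
    ∃ γ : ℝ → ℝ × ℝ, γ 0 = p ∧ ∃ ε > 0, ∀ t ∈ Ioo (-ε) ε,
      γ t ∈ halfPlane ∧ HasDerivAt γ (Y (γ t)) t := by
  rcases (show 0 ≤ p.2 from hp).eq_or_lt with h0 | h0
  · have hX : ContDiff ℝ 1 (fun x : ℝ => (Y (x, 0)).1) := by fun_prop
    obtain ⟨x, hx0, ε, hε, hx⟩ :=
      hX.contDiffAt.exists_forall_mem_closedBall_exists_eq_forall_mem_Ioo_hasDerivAt₀
        (x₀ := p.1) 0
    refine ⟨fun t => (x t, 0), Prod.ext hx0 h0, ε, hε, fun t ht => ⟨le_refl (0 : ℝ), ?_⟩⟩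
    have := (hx t (by simpa using ht)).prodMk (hasDerivAt_const t (0 : ℝ))
    convert this using 1
    exact Prod.ext rfl (htan (x t, 0) rfl)
  · obtain ⟨γ, hγ0, ε, hε, hγ⟩ :=
      hY.contDiffAt.exists_forall_mem_closedBall_exists_eq_forall_mem_Ioo_hasDerivAt₀
        (x₀ := p) 0
    simp only [zero_sub, zero_add] at hγ
    have hc : ContinuousAt γ 0 := (hγ 0 ⟨by linarith, hε⟩).continuousAt
    have hpos : ∀ᶠ t in 𝓝 (0 : ℝ), 0 < (γ t).2 :=
      (continuous_snd.continuousAt.comp hc).eventually_const_lt (by simpa [hγ0] using h0)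
    obtain ⟨δ, hδ, hb⟩ := Metric.eventually_nhds_iff.1 hpos
    refine ⟨γ, hγ0, min ε δ, lt_min hε hδ, fun t ht => ⟨(hb ?_).le, hγ t ?_⟩⟩
    · rw [dist_zero_right, Real.norm_eq_abs, abs_lt]
      exact ⟨by linarith [ht.1, min_le_right ε δ], by linarith [ht.2, min_le_right ε δ]⟩
    · exact ⟨by linarith [ht.1, min_le_left ε δ], by linarith [ht.2, min_le_left ε δ]⟩

/-- A function that increases along trajectories has a local maximum, relative to the half-plane,
at a point with a strict Lyapunov function. -/
theorem exists_nhds_le_of_lyapunov {Y : ℝ × ℝ → ℝ × ℝ} (hY : ContDiff ℝ 1 Y)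
    (htan : ∀ p, p.2 = 0 → (Y p).2 = 0) {V : Set (ℝ × ℝ)} (hV : IsOpen V) {F : ℝ × ℝ → ℝ}
    (hF : ContinuousOn F (V ∩ halfPlane))
    (hmono : ∀ γ T, 0 ≤ T → IsTrajectory Y (V ∩ halfPlane) γ T → F (γ 0) ≤ F (γ T))
    {q : ℝ × ℝ} (hqV : q ∈ V) (hqH : q ∈ halfPlane) {Λ : ℝ × ℝ → ℝ}
    {Λ' : ℝ × ℝ → ℝ × ℝ →L[ℝ] ℝ} {m r : ℝ} (hm : 0 < m) (hr : 0 < r) (hΛq : Λ q = 0)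
    (hΛm : ∀ p, m * ‖p - q‖ ^ 2 ≤ Λ p) (hΛ : ∀ p, HasFDerivAt Λ (Λ' p) p)
    (hdec : ∀ p ∈ halfPlane, ‖p - q‖ ≤ r → p ≠ q → Λ' p (Y p) < 0) :
    ∃ N ∈ 𝓝 q, ∀ p ∈ N ∩ halfPlane, p ∈ V ∧ F p ≤ F q := by
  have hΛc : Continuous Λ := continuous_iff_continuousAt.2 fun p => (hΛ p).continuousAt
  obtain ⟨ρ₀, hρ₀, hρV⟩ := Metric.isOpen_iff.1 hV q hqV
  obtain ⟨ρ, hρ, hρr, hρρ₀⟩ : ∃ ρ > 0, ρ ≤ r ∧ ρ < ρ₀ :=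
    ⟨min r (ρ₀ / 2), lt_min hr (half_pos hρ₀), min_le_left _ _,
      (min_le_right _ _).trans_lt (half_lt_self hρ₀)⟩
  set D : Set (ℝ × ℝ) := {p | Λ p ≤ m * ρ ^ 2} ∩ halfPlane with hD
  have hDnorm : ∀ p ∈ D, ‖p - q‖ ≤ ρ := fun p hp =>
    le_of_sq_le_sq (le_of_mul_le_mul_left ((hΛm p).trans hp.1) hm) hρ.le
  have hDV : D ⊆ V ∩ halfPlane := fun p hp =>
    ⟨hρV (by rw [Metric.mem_ball, dist_eq_norm]; exact (hDnorm p hp).trans_lt hρρ₀), hp.2⟩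
  have hDclosed : IsClosed D := (isClosed_le hΛc continuous_const).inter isClosed_halfPlane
  have hDcompact : IsCompact D :=
    (isCompact_closedBall q ρ).of_isClosed_subset hDclosed fun p hp => by
      rw [Metric.mem_closedBall, dist_eq_norm]; exact hDnorm p hp
  have hqD : q ∈ D := ⟨by rw [mem_ofPred_eq, hΛq]; positivity, hqH⟩
  -- Among the maximum points of `F` on the compact sublevel set `D`, take one with the least `Λ`.
  -- If it were not `q`, a short piece of trajectory would stay in `D`, keep `F` maximal and lower
  -- `Λ`. Only short-time existence of trajectories is needed.
  obtain ⟨pM, hpM, hmax⟩ := hDcompact.exists_isMaxOn ⟨q, hqD⟩ (hF.mono hDV)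
  set K : Set (ℝ × ℝ) := D ∩ F ⁻¹' {F pM} with hK
  have hKcompact : IsCompact K := hDcompact.of_isClosed_subset
    ((hF.mono hDV).preimage_isClosed_of_isClosed hDclosed isClosed_singleton) inter_subset_left
  obtain ⟨p, hpK, hmin⟩ := hKcompact.exists_isMinOn ⟨pM, hpM, rfl⟩ hΛc.continuousOn
  have hpq : p = q := by
    by_contra hpq
    obtain ⟨γ, hγ0, ε, hε, hγ⟩ := exists_local_trajectory hY htan hpK.1.2
    have h0 := (hγ 0 ⟨by linarith, hε⟩).2
    have hΛγ : HasDerivAt (fun t => Λ (γ t)) (Λ' p (Y p)) 0 := by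
      have := (hΛ (γ 0)).comp_hasDerivAt 0 h0
      rwa [hγ0] at this
    have hneg := hdec p hpK.1.2 ((hDnorm p hpK.1).trans hρr) hpq
    have hlt : ∀ᶠ t in 𝓝[>] (0 : ℝ), Λ (γ t) < Λ p := by
      have h1 := (hasDerivWithinAt_iff_tendsto_slope' self_notMem_Ioi).1
        (hΛγ.hasDerivWithinAt (s := Ioi 0))
      filter_upwards [h1.eventually_lt_const hneg, self_mem_nhdsWithin] with t ht ht0
      rw [slope_def_field, sub_zero, hγ0, div_neg_iff] at ht
      rcases ht with ht | ht
      · exact absurd ht0 ht.2.not_gt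
      · linarith [ht.1]
    have hVt : ∀ᶠ t in 𝓝 (0 : ℝ), γ t ∈ V :=
      h0.continuousAt (hV.mem_nhds (by rw [hγ0]; exact (hDV hpK.1).1))
    obtain ⟨δ, hδ, hb⟩ := Metric.eventually_nhds_iff.1 hVt
    obtain ⟨t, htlt, ht⟩ := (hlt.and (Ioo_mem_nhdsGT (lt_min hε hδ))).exists
    have ht0 := ht.1
    have htraj : IsTrajectory Y (V ∩ halfPlane) γ t := fun s hs => by
      have hs1 : s ∈ Ioo (-ε) ε :=
        ⟨by linarith [hs.1], by linarith [hs.2, ht.2, min_le_left ε δ]⟩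
      refine ⟨⟨hb ?_, (hγ s hs1).1⟩, (hγ s hs1).2.hasDerivWithinAt⟩
      rw [dist_zero_right, Real.norm_eq_abs, abs_of_nonneg hs.1]
      linarith [hs.2, ht.2, min_le_right ε δ]
    have htD : γ t ∈ D :=
      ⟨htlt.le.trans hpK.1.1, (htraj t (right_mem_Icc.2 ht0.le)).1.2⟩
    have hFt : F (γ t) = F pM := by
      refine le_antisymm (hmax htD) ?_
      have := hmono γ t ht0.le htraj
      rwa [hγ0, show F p = F pM from hpK.2] at this
    exact (hmin (show γ t ∈ K from ⟨htD, hFt⟩)).not_gt htlt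
  refine ⟨{p | Λ p < m * ρ ^ 2}, (isOpen_lt hΛc continuous_const).mem_nhds ?_, fun p' hp' => ?_⟩
  · rw [mem_ofPred_eq, hΛq]; positivity
  · have hp'D : p' ∈ D := ⟨show Λ p' ≤ _ from le_of_lt hp'.1, hp'.2⟩
    refine ⟨(hDV hp'D).1, ?_⟩
    rw [← hpq, show F p = F pM from hpK.2]
    exact hmax hp'D

/-- The Lyapunov functions `u² + v² + e u v`, with `(u, v)` the displacement from `q`. -/
theorem exists_nhds_le_of_quadratic_lyapunov {Y : ℝ × ℝ → ℝ × ℝ} (hY : ContDiff ℝ 1 Y)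
    (htan : ∀ p, p.2 = 0 → (Y p).2 = 0) {V : Set (ℝ × ℝ)} (hV : IsOpen V) {F : ℝ × ℝ → ℝ}
    (hF : ContinuousOn F (V ∩ halfPlane))
    (hmono : ∀ γ T, 0 ≤ T → IsTrajectory Y (V ∩ halfPlane) γ T → F (γ 0) ≤ F (γ T))
    {q : ℝ × ℝ} (hqV : q ∈ V) (hqH : q ∈ halfPlane) {e r : ℝ} (he : |e| ≤ 1) (hr : 0 < r)
    (hdec : ∀ u v : ℝ, |u| ≤ r → |v| ≤ r → 0 < u ^ 2 + v ^ 2 →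
      (2 * u + e * v) * (Y (q + (u, v))).1 + (2 * v + e * u) * (Y (q + (u, v))).2 < 0) :
    ∃ N ∈ 𝓝 q, ∀ p ∈ N ∩ halfPlane, p ∈ V ∧ F p ≤ F q := by
  have h1 : ∀ p : ℝ × ℝ, HasFDerivAt (fun p : ℝ × ℝ => p.1 - q.1)
    (ContinuousLinearMap.fst ℝ ℝ ℝ) p := fun p => hasFDerivAt_fst.sub_const q.1
  have h2 : ∀ p : ℝ × ℝ, HasFDerivAt (fun p : ℝ × ℝ => p.2 - q.2)
    (ContinuousLinearMap.snd ℝ ℝ ℝ) p := fun p => hasFDerivAt_snd.sub_const q.2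
  -- For `|e| ≤ 1` the quadratic form is at least half of `u² + v²`, which dominates the square of
  -- the sup norm; hence `m = 1 / 2`.
  refine exists_nhds_le_of_lyapunov hY htan hV hF hmono hqV hqH (m := 1 / 2)
    (Λ := fun p => (p.1 - q.1) ^ 2 + (p.2 - q.2) ^ 2 + e * (p.1 - q.1) * (p.2 - q.2))
    (by norm_num) hr (by simp) (fun p => ?_)
    (fun p => (((h1 p).pow 2).add ((h2 p).pow 2)).add (((h1 p).const_mul e).mul (h2 p)))
    (fun p _ hpr hpq => ?_)
  · obtain ⟨he1, he2⟩ := abs_le.1 he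
    have h3 : ‖p - q‖ ^ 2 ≤ (p.1 - q.1) ^ 2 + (p.2 - q.2) ^ 2 := by
      rw [Prod.norm_def]
      rcases max_cases ‖(p - q).1‖ ‖(p - q).2‖ with h | h <;> rw [h.1, Real.norm_eq_abs, sq_abs]
      · simpa using sq_nonneg _
      · simpa using sq_nonneg _
    nlinarith [mul_nonneg (sub_nonneg.2 he2) (sq_nonneg (p.1 - q.1 - (p.2 - q.2))),
      mul_nonneg (neg_le_iff_add_nonneg.1 he1) (sq_nonneg (p.1 - q.1 + (p.2 - q.2)))]
  · have hpe : q + (p.1 - q.1, p.2 - q.2) = p := by ext <;> simp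
    have h3 := hdec (p.1 - q.1) (p.2 - q.2) ((norm_fst_le (p - q)).trans hpr)
      ((norm_snd_le (p - q)).trans hpr) ?_
    · rw [hpe] at h3
      simp
      linarith
    · by_contra! h
      refine hpq (Prod.ext ?_ ?_)
      · nlinarith [sq_nonneg (p.1 - q.1), sq_nonneg (p.2 - q.2)]
      · nlinarith [sq_nonneg (p.1 - q.1), sq_nonneg (p.2 - q.2)]

/-- Reversing time and the sign of `F` exchanges minima with maxima. -/
theorem exists_nhds_ge_of_quadratic_lyapunov {Y : ℝ × ℝ → ℝ × ℝ} (hY : ContDiff ℝ 1 Y)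
    (htan : ∀ p, p.2 = 0 → (Y p).2 = 0) {V : Set (ℝ × ℝ)} (hV : IsOpen V) {F : ℝ × ℝ → ℝ}
    (hF : ContinuousOn F (V ∩ halfPlane))
    (hmono : ∀ γ T, 0 ≤ T → IsTrajectory Y (V ∩ halfPlane) γ T → F (γ 0) ≤ F (γ T))
    {q : ℝ × ℝ} (hqV : q ∈ V) (hqH : q ∈ halfPlane) {e r : ℝ} (he : |e| ≤ 1) (hr : 0 < r)
    (hinc : ∀ u v : ℝ, |u| ≤ r → |v| ≤ r → 0 < u ^ 2 + v ^ 2 →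
      0 < (2 * u + e * v) * (Y (q + (u, v))).1 + (2 * v + e * u) * (Y (q + (u, v))).2) :
    ∃ N ∈ 𝓝 q, ∀ p ∈ N ∩ halfPlane, p ∈ V ∧ F q ≤ F p := by
  have h := exists_nhds_le_of_quadratic_lyapunov (Y := -Y) hY.neg
    (fun p hp => by simp [htan p hp]) hV hF.neg
    (fun γ T hT h => by simpa using hmono _ T hT h.reverse) hqV hqH he hr
    (fun u v hu hv huv => by
      have := hinc u v hu hv huv
      simp only [Pi.neg_apply, Prod.fst_neg, Prod.snd_neg]
      linarith)
  simpa using h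

/-! ### The extremal behaviour at the sources and sinks of the normal forms -/

section LocalExtrema

variable {V : Set (ℝ × ℝ)} {F : ℝ × ℝ → ℝ}

theorem quadraticField_tangent (α β γ δ a : ℝ) (p : ℝ × ℝ) (hp : p.2 = 0) :
    (quadraticField α β γ δ a p).2 = 0 := by
  simp [quadraticField, hp]

theorem boundary_source_locally_minimal (hV : IsOpen V) (hF : ContinuousOn F (V ∩ halfPlane))
    (hmono : ∀ γ T, 0 ≤ T →
      IsTrajectory (quadraticField 1 (-1) 2 (-1) (-1)) (V ∩ halfPlane) γ T → F (γ 0) ≤ F (γ T))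
    (hq : ((1, 0) : ℝ × ℝ) ∈ V) :
    ∃ N ∈ 𝓝 ((1, 0) : ℝ × ℝ), ∀ p ∈ N ∩ halfPlane, p ∈ V ∧ F (1, 0) ≤ F p := by
  refine exists_nhds_ge_of_quadratic_lyapunov (contDiff_quadraticField ..)
    (quadraticField_tangent _ _ _ _ _) hV hF hmono hq (le_refl (0 : ℝ)) (e := 0) (r := 1 / 2)
    (by norm_num) (by norm_num) fun u v hu hv huv => ?_
  obtain ⟨hu1, hu2⟩ := abs_le.1 hu
  simp only [quadraticField, Prod.mk_add_mk]
  -- The expression equals `2 u² (2 + u) + 2 v² (1 + u)`, positive for `|u| ≤ 1 / 2`.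
  nlinarith [mul_nonneg (sq_nonneg u) (neg_le_iff_add_nonneg.1 hu1),
    mul_nonneg (sq_nonneg v) (neg_le_iff_add_nonneg.1 hu1), sq_nonneg u, sq_nonneg v]

theorem boundary_sink_locally_maximal (hV : IsOpen V) (hF : ContinuousOn F (V ∩ halfPlane))
    (hmono : ∀ γ T, 0 ≤ T →
      IsTrajectory (quadraticField 1 (-1) 2 1 (-1)) (V ∩ halfPlane) γ T → F (γ 0) ≤ F (γ T))
    (hq : ((-1, 0) : ℝ × ℝ) ∈ V) :
    ∃ N ∈ 𝓝 ((-1, 0) : ℝ × ℝ), ∀ p ∈ N ∩ halfPlane, p ∈ V ∧ F p ≤ F (-1, 0) := by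
  refine exists_nhds_le_of_quadratic_lyapunov (contDiff_quadraticField ..)
    (quadraticField_tangent _ _ _ _ _) hV hF hmono hq (le_refl (0 : ℝ)) (e := 0) (r := 1 / 2)
    (by norm_num) (by norm_num) fun u v hu hv huv => ?_
  obtain ⟨hu1, hu2⟩ := abs_le.1 hu
  simp only [quadraticField, Prod.mk_add_mk]
  nlinarith [mul_nonneg (sq_nonneg u) (sub_nonneg.2 hu2),
    mul_nonneg (sq_nonneg v) (sub_nonneg.2 hu2), sq_nonneg u, sq_nonneg v]

/-- Bounds for the height of the interior singular points for `a = 1`. -/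
theorem interior_height_bounds : (√5 / 2) ^ 2 = 5 / 4 ∧ 1 ≤ √5 / 2 ∧ √5 / 2 ≤ 6 / 5 := by
  have h : √5 ^ 2 = 5 := Real.sq_sqrt (by norm_num)
  have h0 := Real.sqrt_nonneg 5
  refine ⟨by linarith, ?_, ?_⟩ <;> nlinarith

theorem interior_sink_locally_maximal (hV : IsOpen V) (hF : ContinuousOn F (V ∩ halfPlane))
    (hmono : ∀ γ T, 0 ≤ T →
      IsTrajectory (quadraticField 1 (-1) 2 1 1) (V ∩ halfPlane) γ T → F (γ 0) ≤ F (γ T))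
    (hq : ((-1 / 2, √5 / 2) : ℝ × ℝ) ∈ V) :
    ∃ N ∈ 𝓝 ((-1 / 2, √5 / 2) : ℝ × ℝ), ∀ p ∈ N ∩ halfPlane,
      p ∈ V ∧ F p ≤ F (-1 / 2, √5 / 2) := by
  obtain ⟨hs, hs1, hs2⟩ := interior_height_bounds
  -- The linear part has rows `(-1, -√5)` and `(√5, 0)`, so `u² + v²` alone decreases only to the
  -- order `-2 u²`. The cross term `u v / 4` supplies the missing negative `v²`, and `r = 1 / 20`
  -- makes the cubic terms negligible.
  refine exists_nhds_le_of_quadratic_lyapunov (contDiff_quadraticField ..)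
    (quadraticField_tangent _ _ _ _ _) hV hF hmono hq (by simp only [halfPlane, mem_ofPred_eq]; linarith) (e := 1 / 4) (r := 1 / 20)
    (by norm_num [abs_le]) (by norm_num) fun u v hu hv huv => ?_
  obtain ⟨hu1, hu2⟩ := abs_le.1 hu
  obtain ⟨hv1, hv2⟩ := abs_le.1 hv
  simp only [quadraticField, Prod.mk_add_mk]
  generalize √5 / 2 = s at *
  have key : (2 * u + 1 / 4 * v) * (1 * ((-1 / 2 + u) ^ 2 + 1) + -1 * (s + v) ^ 2) +
      (2 * v + 1 / 4 * u) * ((2 * (-1 / 2 + u) + 1) * (s + v)) =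
      -2 * u ^ 2 + s / 2 * u ^ 2 - s / 2 * v ^ 2 - u * v / 4 +
        (2 * u + v / 4) * u ^ 2 + (2 * u - v / 4) * v ^ 2 + u ^ 2 * v / 2 := by
    linear_combination (-(2 * u) - v / 4) * hs
  rw [key]
  nlinarith [mul_nonneg (sq_nonneg u) (sub_nonneg.2 hu2), mul_nonneg (sq_nonneg u) (sub_nonneg.2 hv2),
    mul_nonneg (sq_nonneg v) (sub_nonneg.2 hu2),
    mul_nonneg (sq_nonneg v) (neg_le_iff_add_nonneg.1 hv1), sq_nonneg (u + v),
    mul_nonneg (sq_nonneg u) (sub_nonneg.2 hs2), mul_nonneg (sq_nonneg v) (sub_nonneg.2 hs1)]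

theorem interior_source_locally_minimal (hV : IsOpen V) (hF : ContinuousOn F (V ∩ halfPlane))
    (hmono : ∀ γ T, 0 ≤ T →
      IsTrajectory (quadraticField 1 (-1) 2 (-1) 1) (V ∩ halfPlane) γ T → F (γ 0) ≤ F (γ T))
    (hq : ((1 / 2, √5 / 2) : ℝ × ℝ) ∈ V) :
    ∃ N ∈ 𝓝 ((1 / 2, √5 / 2) : ℝ × ℝ), ∀ p ∈ N ∩ halfPlane,
      p ∈ V ∧ F (1 / 2, √5 / 2) ≤ F p := by
  obtain ⟨hs, hs1, hs2⟩ := interior_height_bounds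
  refine exists_nhds_ge_of_quadratic_lyapunov (contDiff_quadraticField ..)
    (quadraticField_tangent _ _ _ _ _) hV hF hmono hq (by simp only [halfPlane, mem_ofPred_eq]; linarith) (e := -(1 / 4)) (r := 1 / 20)
    (by norm_num [abs_le]) (by norm_num) fun u v hu hv huv => ?_
  obtain ⟨hu1, hu2⟩ := abs_le.1 hu
  obtain ⟨hv1, hv2⟩ := abs_le.1 hv
  simp only [quadraticField, Prod.mk_add_mk]
  generalize √5 / 2 = s at *
  have key : (2 * u + -(1 / 4) * v) * (1 * ((1 / 2 + u) ^ 2 + 1) + -1 * (s + v) ^ 2) +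
      (2 * v + -(1 / 4) * u) * ((2 * (1 / 2 + u) + -1) * (s + v)) =
      2 * u ^ 2 - s / 2 * u ^ 2 + s / 2 * v ^ 2 - u * v / 4 +
        (2 * u - v / 4) * u ^ 2 + (2 * u + v / 4) * v ^ 2 - u ^ 2 * v / 2 := by
    linear_combination (-(2 * u) + v / 4) * hs
  rw [key]
  nlinarith [mul_nonneg (sq_nonneg u) (neg_le_iff_add_nonneg.1 hu1),
    mul_nonneg (sq_nonneg u) (sub_nonneg.2 hv2),
    mul_nonneg (sq_nonneg v) (neg_le_iff_add_nonneg.1 hu1),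
    mul_nonneg (sq_nonneg v) (neg_le_iff_add_nonneg.1 hv1), sq_nonneg (u - v),
    mul_nonneg (sq_nonneg u) (sub_nonneg.2 hs2), mul_nonneg (sq_nonneg v) (sub_nonneg.2 hs1)]

end LocalExtrema

/-- The interior singular point for `a = 1` in the fourth and the fifth family. -/
theorem singularPoints_interior {σ : ℝ} (hσ : σ ^ 2 = 1) :
    singularPoints (quadraticField 1 (-1) 2 σ 1) = {(-σ / 2, √5 / 2)} := by
  obtain ⟨hs, hs1, -⟩ := interior_height_bounds
  ext ⟨x, y⟩
  simp only [mem_singularPoints_quadraticField, mem_singleton_iff, Prod.mk.injEq]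
  constructor
  · rintro ⟨h0, h1, h2 | rfl⟩
    · obtain rfl : x = -σ / 2 := by linarith
      exact ⟨rfl, by nlinarith⟩
    · nlinarith [sq_nonneg x]
  · rintro ⟨rfl, rfl⟩
    exact ⟨by linarith, by nlinarith, Or.inl (by ring)⟩

/-! ### Linear parts of gradients at extrema -/

theorem det_euclidean_eq (L : EuclideanSpace ℝ (Fin 2) →L[ℝ] EuclideanSpace ℝ (Fin 2)) :
    LinearMap.det (L : EuclideanSpace ℝ (Fin 2) →ₗ[ℝ] EuclideanSpace ℝ (Fin 2)) =
      L (EuclideanSpace.single 0 1) 0 * L (EuclideanSpace.single 1 1) 1 -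
        L (EuclideanSpace.single 1 1) 0 * L (EuclideanSpace.single 0 1) 1 := by
  rw [← LinearMap.det_toMatrix (EuclideanSpace.basisFun (Fin 2) ℝ).toBasis, Matrix.det_fin_two]
  simp [LinearMap.toMatrix_apply]

theorem trace_euclidean_eq (L : EuclideanSpace ℝ (Fin 2) →L[ℝ] EuclideanSpace ℝ (Fin 2)) :
    LinearMap.trace ℝ (EuclideanSpace ℝ (Fin 2))
      (L : EuclideanSpace ℝ (Fin 2) →ₗ[ℝ] EuclideanSpace ℝ (Fin 2)) =
      L (EuclideanSpace.single 0 1) 0 + L (EuclideanSpace.single 1 1) 1 := by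
  rw [LinearMap.trace_eq_matrix_trace ℝ (EuclideanSpace.basisFun (Fin 2) ℝ).toBasis,
    Matrix.trace_fin_two]
  simp [LinearMap.toMatrix_apply]

theorem euclidean_eq_sum (w : EuclideanSpace ℝ (Fin 2)) :
    w = w 0 • EuclideanSpace.single 0 1 + w 1 • EuclideanSpace.single 1 1 := by
  ext i
  fin_cases i <;> simp

/-- `E, F, G` are the entries of the Gram matrix of the metric and `a, b, c, d` those of `L`. The
product of the two matrices need not be symmetric, but its antisymmetric part can only increase the
determinant. -/
theorem det_trace_nonneg_aux {E F G a b c d : ℝ} (hE : 0 < E) (hD : 0 < E * G - F ^ 2)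
    (h : ∀ x y : ℝ, 0 ≤ x ^ 2 * (a * E + c * F) + x * y * (a * F + c * G + (b * E + d * F)) +
      y ^ 2 * (b * F + d * G)) : 0 ≤ a * d - b * c ∧ 0 ≤ a + d := by
  have h1 := h 1 0
  constructor
  · have hdisc : (a * F + c * G + (b * E + d * F)) ^ 2 ≤ 4 * (a * E + c * F) * (b * F + d * G) := by
      have := discrim_le_zero (a := a * E + c * F) (b := a * F + c * G + (b * E + d * F))
        (c := b * F + d * G) fun x => by have := h x 1; linarith
      rw [discrim] at this
      linarith
    have h3 : (E * G - F ^ 2) * (a * d - b * c) =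
        (a * E + c * F) * (b * F + d * G) - (a * F + c * G) * (b * E + d * F) := by ring
    have h4 : 0 ≤ (E * G - F ^ 2) * (a * d - b * c) := by
      rw [h3]
      nlinarith [sq_nonneg (a * F + c * G - (b * E + d * F))]
    exact nonneg_of_mul_nonneg_right h4 hD
  -- The vectors `(1, 0)` and `(-F, E)` are orthogonal for the metric, so the trace is a positive
  -- combination of the form's values on them.
  · have h2 := h (-F) E
    have h3 : E * ((E * G - F ^ 2) * (a + d)) = (E * G - F ^ 2) * (a * E + c * F) +
      ((-F) ^ 2 * (a * E + c * F) + -F * E * (a * F + c * G + (b * E + d * F)) +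
        E ^ 2 * (b * F + d * G)) := by ring
    have h4 : 0 ≤ E * ((E * G - F ^ 2) * (a + d)) := by
      rw [h3]
      have := mul_nonneg hD.le (by linarith : 0 ≤ a * E + c * F)
      linarith
    exact nonneg_of_mul_nonneg_right (nonneg_of_mul_nonneg_right h4 hE) hD

theorem det_trace_nonneg
    (B : EuclideanSpace ℝ (Fin 2) →L[ℝ] EuclideanSpace ℝ (Fin 2) →L[ℝ] ℝ)
    (hsymm : ∀ v w, B v w = B w v) (hpos : ∀ v, v ≠ 0 → 0 < B v v)
    (L : EuclideanSpace ℝ (Fin 2) →L[ℝ] EuclideanSpace ℝ (Fin 2)) (h : ∀ v, 0 ≤ B (L v) v) :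
    0 ≤ LinearMap.det (L : EuclideanSpace ℝ (Fin 2) →ₗ[ℝ] EuclideanSpace ℝ (Fin 2)) ∧
    0 ≤ LinearMap.trace ℝ _ (L : EuclideanSpace ℝ (Fin 2) →ₗ[ℝ] EuclideanSpace ℝ (Fin 2)) := by
  rw [det_euclidean_eq, trace_euclidean_eq]
  set e₀ : EuclideanSpace ℝ (Fin 2) := EuclideanSpace.single 0 1 with he₀
  set e₁ : EuclideanSpace ℝ (Fin 2) := EuclideanSpace.single 1 1 with he₁
  have hB : ∀ v w, B v w = v 0 * (w 0 * B e₀ e₀ + w 1 * B e₀ e₁) +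
      v 1 * (w 0 * B e₀ e₁ + w 1 * B e₁ e₁) := fun v w => by
    conv_lhs => rw [euclidean_eq_sum v, euclidean_eq_sum w]
    simp only [← he₀, ← he₁, map_add, map_smul, add_apply, smul_apply, smul_eq_mul, hsymm e₁ e₀]
    ring
  have hE : 0 < B e₀ e₀ := hpos _ (by simp [he₀])
  refine det_trace_nonneg_aux (E := B e₀ e₀) (F := B e₀ e₁) (G := B e₁ e₁) hE ?_ fun x y => ?_
  -- On this vector, orthogonal to `e₀`, the metric equals `E (E G - F²)`.
  · have h1 := hpos (-(B e₀ e₁) • e₀ + B e₀ e₀ • e₁) fun h0 => by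
      have := congrArg (fun v : EuclideanSpace ℝ (Fin 2) => v 1) h0
      simp [he₀, he₁] at this
      exact hpos e₀ (by simp [he₀]) |>.ne' this
    rw [hB] at h1
    simp [he₀, he₁] at h1
    rw [← he₀, ← he₁] at h1
    have h2 : 0 < B e₀ e₀ * (B e₀ e₀ * B e₁ e₁ - B e₀ e₁ ^ 2) := by linarith
    exact (mul_pos_iff_of_pos_left hE).1 h2
  · have h1 := h (x • e₀ + y • e₁)
    rw [hB] at h1
    simp only [map_add, map_smul] at h1
    simp [he₀, he₁] at h1
    rw [← he₀, ← he₁] at h1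
    linarith

/-! ### Singular points and equivalences of flows -/

theorem IsTrajectory.singular_of_eqOn_const {Y : ℝ × ℝ → ℝ × ℝ} {A : Set (ℝ × ℝ)}
    {δ : ℝ → ℝ × ℝ} {T : ℝ} {q : ℝ × ℝ} (hδ : IsTrajectory Y A δ T) (hT : 0 < T)
    (h : ∀ t ∈ Icc 0 T, δ t = q) : Y q = 0 := by
  have h0 : (0 : ℝ) ∈ Icc 0 T := left_mem_Icc.2 hT.le
  have h1 := (hδ 0 h0).2
  rw [h 0 h0] at h1
  exact (uniqueDiffOn_Icc hT 0 h0).eq_deriv _ h1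
    ((hasDerivWithinAt_const 0 (Icc 0 T) q).congr h (h 0 h0))

/-- A constant trajectory goes to a constant one; strict monotonicity of the time change gives it
positive length, and continuity makes it cover the whole time interval. -/
theorem MapsTrajectories.singular_image {P : Type*} {S : (ℝ → P) → ℝ → Prop}
    {Y : ℝ × ℝ → ℝ × ℝ} {B : Set (ℝ × ℝ)} {h : P → ℝ × ℝ}
    (hS : MapsTrajectories S (IsTrajectory Y B) h) {p : P} (hp : S (fun _ => p) 1) :
    Y (h p) = 0 := by
  obtain ⟨δ, T, τ, hT, hδ, hτc, hτm, h0, h1, hτ⟩ := hS _ 1 zero_le_one hp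
  have hT' : 0 < T := by
    rw [← h0, ← h1]
    exact hτm (left_mem_Icc.2 zero_le_one) (right_mem_Icc.2 zero_le_one) zero_lt_one
  refine hδ.singular_of_eqOn_const hT' fun t ht => ?_
  rw [← h0, ← h1] at ht
  obtain ⟨s, hs, rfl⟩ := intermediate_value_Icc zero_le_one hτc ht
  exact (hτ s hs).symm

section Surface

variable {M : Type*} [TopologicalSpace M] [ChartedSpace (EuclideanHalfSpace 2) M]

theorem isSurfaceTrajectory_const {X : ∀ p : M, TangentSpace (𝓡∂ 2) p} {A : Set M} {p : M}
    (hp : p ∈ A) (hX : X p = 0) (T : ℝ) : IsSurfaceTrajectory X A (fun _ => p) T := by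
  refine ⟨fun _ _ => hp, fun t _ => ?_⟩
  have h : (1 : ℝ →L[ℝ] ℝ).smulRight (X p) = 0 := by
    ext; simp [hX]
  simp only [h]
  exact hasMFDerivWithinAt_const p (Icc 0 T) t

theorem eventually_ray_mem_range {u v : EuclideanSpace ℝ (Fin 2)} (hu : u ∈ range (𝓡∂ 2))
    (hv : u 0 = 0 → v 0 = 0) : ∀ᶠ s in 𝓝 (0 : ℝ), u + s • v ∈ range (𝓡∂ 2) := by
  rw [range_modelWithCornersEuclideanHalfSpace] at hu ⊢
  rcases (show 0 ≤ u 0 from hu).eq_or_lt with h | h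
  · refine Eventually.of_forall fun s => ?_
    simp [← h, hv h.symm]
  · have hc : ContinuousAt (fun s : ℝ => u 0 + s * v 0) 0 := by fun_prop
    filter_upwards [hc.eventually_const_lt (by simpa using h)] with s hs
    simpa using hs.le

theorem tendsto_extChartAt_symm (p : M) :
    Tendsto (extChartAt (𝓡∂ 2) p).symm (𝓝[range (𝓡∂ 2)] (extChartAt (𝓡∂ 2) p p)) (𝓝 p) := by
  have h := (continuousAt_extChartAt_symm (I := 𝓡∂ 2) p).tendsto.mono_left
    (nhdsWithin_le_nhds (s := range (𝓡∂ 2)))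
  rwa [extChartAt_to_inv] at h

/-- The potential in the chart at a point has the derivative of the potential. -/
theorem hasFDerivWithinAt_comp_extChartAt_symm {f : M → ℝ}
    (hf : ContMDiff (𝓡∂ 2) 𝓘(ℝ, ℝ) 2 f) (p : M) :
    HasFDerivWithinAt (f ∘ (extChartAt (𝓡∂ 2) p).symm) (mfderiv (𝓡∂ 2) 𝓘(ℝ, ℝ) f p)
      (range (𝓡∂ 2)) (extChartAt (𝓡∂ 2) p p) := by
  have h := ((hf.mdifferentiable two_ne_zero p).hasMFDerivAt).2
  simpa [writtenInExtChartAt] using! h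

variable [IsManifold (𝓡∂ 2) ∞ M] {X : ∀ p : M, TangentSpace (𝓡∂ 2) p} {f : M → ℝ}
  {g : Bundle.ContMDiffRiemannianMetric (𝓡∂ 2) 1 (EuclideanSpace ℝ (Fin 2))
      (fun p : M => TangentSpace (𝓡∂ 2) p)}

theorem IsSurfaceTrajectory.monotoneOn_potential (hf : ContMDiff (𝓡∂ 2) 𝓘(ℝ, ℝ) 2 f)
    (hX : ∀ (p : M) (v : TangentSpace (𝓡∂ 2) p),
      g.inner p (X p) v = mfderiv (𝓡∂ 2) 𝓘(ℝ, ℝ) f p v)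
    {A : Set M} {γ : ℝ → M} {T : ℝ} (hγ : IsSurfaceTrajectory X A γ T) :
    MonotoneOn (f ∘ γ) (Icc 0 T) := by
  refine monotoneOn_Icc_of_hasDerivWithinAt_nonneg
    (u' := fun t => g.inner (γ t) (X (γ t)) (X (γ t))) (fun t ht => ?_) fun t _ => ?_
  · have h1 := ((hf.mdifferentiable two_ne_zero (γ t)).hasMFDerivAt).comp_hasMFDerivWithinAt t
      (hγ.2 t ht)
    obtain ⟨L, hL, hL1⟩ : ∃ L : ℝ →L[ℝ] ℝ, HasFDerivWithinAt (f ∘ γ) L (Icc 0 T) t ∧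
        L 1 = mfderiv (𝓡∂ 2) 𝓘(ℝ, ℝ) f (γ t) ((1 : ℝ) • X (γ t)) :=
      ⟨_, h1.hasFDerivWithinAt, rfl⟩
    rw [one_smul, ← hX] at hL1
    exact hL1 ▸ hL.hasDerivWithinAt
  · rcases eq_or_ne (X (γ t)) 0 with h | h
    · simp [h]
    · exact (g.pos _ _ h).le

/-- A gradient tangent to the boundary vanishes at the local extrema of the potential. -/
theorem eq_zero_of_isLocalExtr (hf : ContMDiff (𝓡∂ 2) 𝓘(ℝ, ℝ) 2 f)
    (hX : ∀ (p : M) (v : TangentSpace (𝓡∂ 2) p),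
      g.inner p (X p) v = mfderiv (𝓡∂ 2) 𝓘(ℝ, ℝ) f p v)
    (htan : ∀ p ∈ (𝓡∂ 2).boundary M, WithLp.ofLp (X p) (0 : Fin 2) = (0 : ℝ))
    {p : M} (hp : IsLocalExtr f p) : X p = 0 := by
  set u : EuclideanSpace ℝ (Fin 2) := extChartAt (𝓡∂ 2) p p with hu
  set v : EuclideanSpace ℝ (Fin 2) := X p with hv
  have hur : u ∈ range (𝓡∂ 2) := by
    rw [hu, extChartAt_coe]; exact mem_range_self _
  -- Tangency allows motion along `X p` in both directions even at a boundary point, so the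
  -- two-sided derivative of the potential, `g(X, X)`, vanishes at an extremum.
  have hray := eventually_ray_mem_range (v := v) hur fun h0 => htan p (by
    rw [ModelWithCorners.boundary, mem_ofPred_eq, ModelWithCorners.isBoundaryPoint_iff,
      frontier_range_modelWithCornersEuclideanHalfSpace]
    exact h0.symm)
  have hcd : HasDerivAt (fun s : ℝ => u + s • v) v 0 := by
    simpa using ((hasDerivAt_id (0 : ℝ)).smul_const v).const_add u
  have hd := (hasFDerivWithinAt_comp_extChartAt_symm hf p).comp_hasDerivWithinAt_of_eq
    (s := {s : ℝ | u + s • v ∈ range (𝓡∂ 2)}) (0 : ℝ) hcd.hasDerivWithinAt (fun s hs => hs)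
    (by simp [hu])
  have hd' := hd.hasDerivAt hray
  have ht : Tendsto (fun s : ℝ => (extChartAt (𝓡∂ 2) p).symm (u + s • v)) (𝓝 0) (𝓝 p) := by
    refine (tendsto_extChartAt_symm p).comp (tendsto_nhdsWithin_iff.2 ⟨?_, hray⟩)
    have := hcd.continuousAt.tendsto
    rwa [zero_smul, add_zero] at this
  have h0 : (extChartAt (𝓡∂ 2) p).symm (u + (0 : ℝ) • v) = p := by
    rw [zero_smul, add_zero, hu, extChartAt_to_inv]
  have hext : IsLocalExtr ((f ∘ (extChartAt (𝓡∂ 2) p).symm) ∘ fun s : ℝ => u + s • v) 0 := by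
    have hp' : IsExtrFilter f (𝓝 p) ((extChartAt (𝓡∂ 2) p).symm (u + (0 : ℝ) • v)) := by
      rwa [h0]
    exact hp'.comp_tendsto (g := fun s : ℝ => (extChartAt (𝓡∂ 2) p).symm (u + s • v)) ht
  have h1 := hext.hasDerivAt_eq_zero hd'
  by_contra hne
  exact (g.pos p (X p) hne).ne' ((hX p (X p)).trans h1)

end Surface

/-! ### The linear part of a gradient at an extremum of the potential -/

section Surface

open Bundle

variable {M : Type*} [TopologicalSpace M] [ChartedSpace (EuclideanHalfSpace 2) M]

/-- The field written in the chart at `p`. -/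
noncomputable def chartField (X : ∀ p : M, TangentSpace (𝓡∂ 2) p) (p : M)
    (u : EuclideanSpace ℝ (Fin 2)) : EuclideanSpace ℝ (Fin 2) :=
  mfderiv (𝓡∂ 2) 𝓘(ℝ, EuclideanSpace ℝ (Fin 2)) (extChartAt (𝓡∂ 2) p)
    ((extChartAt (𝓡∂ 2) p).symm u) (X ((extChartAt (𝓡∂ 2) p).symm u))

theorem SingularKind.Holds.det_ne_zero {E : Type*} [NormedAddCommGroup E] [NormedSpace ℝ E]
    {κ : SingularKind} {L : E →L[ℝ] E} (h : κ.Holds L) :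
    LinearMap.det (L : E →ₗ[ℝ] E) ≠ 0 := by
  cases κ
  exacts [ne_of_lt h, h.1.ne', h.1.ne']

/-- The linear part exists as a derivative at a nondegenerate singular point. -/
theorem IsSingularOfKind.hasFDerivWithinAt_chartField
    {X : ∀ p : M, TangentSpace (𝓡∂ 2) p} {κ : SingularKind} {p : M}
    (h : IsSingularOfKind κ X p) :
    HasFDerivWithinAt (chartField X p) (linearPart X p) (range (𝓡∂ 2))
      (extChartAt (𝓡∂ 2) p p) := by
  change HasFDerivWithinAt (chartField X p) (fderivWithin ℝ (chartField X p) (range (𝓡∂ 2))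
    (extChartAt (𝓡∂ 2) p p)) (range (𝓡∂ 2)) (extChartAt (𝓡∂ 2) p p)
  refine DifferentiableWithinAt.hasFDerivWithinAt ?_
  -- Without differentiability `fderivWithin` takes its default value zero, whose determinant
  -- vanishes.
  by_contra hd
  refine h.2.det_ne_zero ?_
  have h0 : linearPart X p = 0 := fderivWithin_zero_of_not_differentiableWithinAt hd
  rw [h0, det_euclidean_eq]
  simp

variable [IsManifold (𝓡∂ 2) ∞ M] {X : ∀ p : M, TangentSpace (𝓡∂ 2) p} {f : M → ℝ}
  {g : Bundle.ContMDiffRiemannianMetric (𝓡∂ 2) 1 (EuclideanSpace ℝ (Fin 2))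
      (fun p : M => TangentSpace (𝓡∂ 2) p)}

/-- The metric in the trivialization of the tangent bundle at `p`. -/
noncomputable def frameInner (g : Bundle.ContMDiffRiemannianMetric (𝓡∂ 2) 1
      (EuclideanSpace ℝ (Fin 2)) (fun p : M => TangentSpace (𝓡∂ 2) p)) (p q : M)
    (w v : EuclideanSpace ℝ (Fin 2)) : ℝ :=
  g.inner q ((trivializationAt (EuclideanSpace ℝ (Fin 2)) (TangentSpace (𝓡∂ 2)) p).symmL ℝ q w)
    ((trivializationAt (EuclideanSpace ℝ (Fin 2)) (TangentSpace (𝓡∂ 2)) p).symmL ℝ q v)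

theorem contMDiffAt_frame (p : M) (v : EuclideanSpace ℝ (Fin 2)) :
    ContMDiffAt (𝓡∂ 2) ((𝓡∂ 2).prod 𝓘(ℝ, EuclideanSpace ℝ (Fin 2))) 1
      (fun q : M => TotalSpace.mk' (EuclideanSpace ℝ (Fin 2)) (E := TangentSpace (𝓡∂ 2)) q
        ((trivializationAt (EuclideanSpace ℝ (Fin 2)) (TangentSpace (𝓡∂ 2)) p).symmL ℝ q v)) p := by
  have : IsManifold (𝓡∂ 2) (1 + 1) M := .of_le (n := ∞) (by norm_cast)
  rw [contMDiffAt_section]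
  refine (contMDiffAt_const (c := v)).congr_of_eventuallyEq ?_
  filter_upwards [(trivializationAt (EuclideanSpace ℝ (Fin 2)) (TangentSpace (𝓡∂ 2))
    p).open_baseSet.mem_nhds (mem_baseSet_trivializationAt _ _ p)] with q hq
  rw [Trivialization.symmL_apply _ hq, Trivialization.apply_mk_symm _ hq]

theorem continuousAt_frameInner (p : M) (w v : EuclideanSpace ℝ (Fin 2)) :
    ContinuousAt (fun q => frameInner g p q w v) p := by
  have h := (g.contMDiff.contMDiffAt (x := p)).clm_bundle_apply₂ (F₃ := ℝ)
    (E₃ := Bundle.Trivial M ℝ) (contMDiffAt_frame p w) (contMDiffAt_frame p v)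
  rw [contMDiffAt_section] at h
  exact h.continuousAt

/-- At its base point the inverse chart has the identity as derivative. -/
theorem frameInner_self (p : M) (w v : EuclideanSpace ℝ (Fin 2)) :
    frameInner g p p w v = g.inner p w v := by
  have : IsManifold (𝓡∂ 2) 1 M := .of_le (n := ∞) (by norm_cast)
  rw [frameInner, TangentBundle.symmL_trivializationAt (mem_chart_source _ p),
    mfderivWithin_range_extChartAt_symm]
  rfl

theorem frameInner_add_smul (p q : M) (a b : ℝ) (w₁ w₂ v : EuclideanSpace ℝ (Fin 2)) :
    frameInner g p q (a • w₁ + b • w₂) v = a * frameInner g p q w₁ v + b * frameInner g p q w₂ v := by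
  simp [frameInner]

theorem frameInner_eq_coordinates (p q : M) (w v : EuclideanSpace ℝ (Fin 2)) :
    frameInner g p q w v = w 0 * frameInner g p q (EuclideanSpace.single 0 1) v +
      w 1 * frameInner g p q (EuclideanSpace.single 1 1) v := by
  conv_lhs => rw [euclidean_eq_sum w]
  exact frameInner_add_smul ..

/-- The trivialization at `p` is given by derivatives of the chart, so writing field and metric in
it preserves their pairing and turns the gradient identity into one in coordinates. -/
theorem hasFDerivWithinAt_potential_in_chart (hf : ContMDiff (𝓡∂ 2) 𝓘(ℝ, ℝ) 2 f)
    (hX : ∀ (p : M) (v : TangentSpace (𝓡∂ 2) p),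
      g.inner p (X p) v = mfderiv (𝓡∂ 2) 𝓘(ℝ, ℝ) f p v)
    {p : M} {u : EuclideanSpace ℝ (Fin 2)} (hu : u ∈ (extChartAt (𝓡∂ 2) p).target) :
    ∃ L : EuclideanSpace ℝ (Fin 2) →L[ℝ] ℝ,
      HasFDerivWithinAt (f ∘ (extChartAt (𝓡∂ 2) p).symm) L (range (𝓡∂ 2)) u ∧
      ∀ v, L v = frameInner g p ((extChartAt (𝓡∂ 2) p).symm u) (chartField X p u) v := by
  have : IsManifold (𝓡∂ 2) 1 M := .of_le (n := ∞) (by norm_cast)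
  set q := (extChartAt (𝓡∂ 2) p).symm u with hq
  have hqs : q ∈ (chartAt (EuclideanHalfSpace 2) p).source := by
    rw [← extChartAt_source (𝓡∂ 2)]; exact (extChartAt (𝓡∂ 2) p).map_target hu
  have huq : extChartAt (𝓡∂ 2) p q = u := (extChartAt (𝓡∂ 2) p).right_inv hu
  have h1 := ((hf.mdifferentiable two_ne_zero q).hasMFDerivAt).comp_hasMFDerivWithinAt u
    (mdifferentiableWithinAt_extChartAt_symm (I := 𝓡∂ 2) hu).hasMFDerivWithinAt
  refine ⟨_, h1.hasFDerivWithinAt, fun v => ?_⟩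
  have hb : q ∈ (trivializationAt (EuclideanSpace ℝ (Fin 2)) (TangentSpace (𝓡∂ 2)) p).baseSet := by
    simpa using hqs
  have h2 : chartField X p u = (trivializationAt (EuclideanSpace ℝ (Fin 2))
      (TangentSpace (𝓡∂ 2)) p).continuousLinearMapAt ℝ q (X q) := by
    rw [TangentBundle.continuousLinearMapAt_trivializationAt hqs]
    rfl
  rw [frameInner, h2, Trivialization.symmL_continuousLinearMapAt _ hb, hX,
    TangentBundle.symmL_trivializationAt hqs, huq]
  rfl

/-- Along the ray `u + s v` the derivative of `c f` is `s c g(L v, v)` to first order. Were this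
coefficient negative, `c f` would strictly decrease from its minimum. Rays are one-sided because `p`
may be a boundary point. -/
theorem inner_linearPart_nonneg_of_inward (hf : ContMDiff (𝓡∂ 2) 𝓘(ℝ, ℝ) 2 f)
    (hX : ∀ (p : M) (v : TangentSpace (𝓡∂ 2) p),
      g.inner p (X p) v = mfderiv (𝓡∂ 2) 𝓘(ℝ, ℝ) f p v)
    {κ : SingularKind} {p : M} (hκ : IsSingularOfKind κ X p) {c : ℝ}
    (hmin : IsLocalMin (fun q => c * f q) p) {v : EuclideanSpace ℝ (Fin 2)} (hv : 0 ≤ v 0) :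
    0 ≤ c * g.inner p (linearPart X p v) v := by
  set u : EuclideanSpace ℝ (Fin 2) := extChartAt (𝓡∂ 2) p p with hu
  have hur : 0 ≤ u 0 := by
    have : u ∈ range (𝓡∂ 2) := by
      rw [hu, extChartAt_coe]; exact mem_range_self _
    rwa [range_modelWithCornersEuclideanHalfSpace] at this
  have hray : ∀ s ∈ Ici (0 : ℝ), u + s • v ∈ range (𝓡∂ 2) := fun s hs => by
    rw [range_modelWithCornersEuclideanHalfSpace]
    have : 0 ≤ u 0 + s * v 0 := add_nonneg hur (mul_nonneg hs hv)
    simpa using this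
  have hcd : ∀ s : ℝ, HasDerivAt (fun s : ℝ => u + s • v) v s := fun s => by
    simpa using ((hasDerivAt_id s).smul_const v).const_add u
  have ht : Tendsto (fun s : ℝ => u + s • v) (𝓝[≥] 0) (𝓝[range (𝓡∂ 2)] u) := by
    refine tendsto_nhdsWithin_iff.2 ⟨?_, eventually_mem_nhdsWithin.mono hray⟩
    have := (hcd 0).continuousAt.tendsto.mono_left (nhdsWithin_le_nhds (s := Ici (0 : ℝ)))
    rwa [zero_smul, add_zero] at this
  have ht' := ht.mono_left (nhdsWithin_mono 0 (Ioi_subset_Ici_self (a := (0 : ℝ))))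
  set q : ℝ → M := fun s => (extChartAt (𝓡∂ 2) p).symm (u + s • v) with hq
  have hq0 : q 0 = p := by
    rw [hq]; simp only; rw [zero_smul, add_zero, hu, extChartAt_to_inv]
  have hqt : Tendsto q (𝓝[≥] 0) (𝓝 p) := (tendsto_extChartAt_symm p).comp ht
  have hqt' : Tendsto q (𝓝[>] 0) (𝓝 p) := (tendsto_extChartAt_symm p).comp ht'
  by_contra! hneg
  have hslope : Tendsto (fun s : ℝ => s⁻¹ • chartField X p (u + s • v)) (𝓝[>] 0)
      (𝓝 (linearPart X p v)) := by
    have h0 : chartField X p u = 0 := by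
      rw [chartField, hu, extChartAt_to_inv, hκ.1]
      exact map_zero _
    have h1 := hκ.hasFDerivWithinAt_chartField.comp_hasDerivWithinAt_of_eq (s := Ioi 0) (0 : ℝ)
      (hcd 0).hasDerivWithinAt (fun s hs => hray s (mem_Ici.2 (le_of_lt (mem_Ioi.1 hs)))) (by simp [hu])
    have h2 := (hasDerivWithinAt_iff_tendsto_slope' self_notMem_Ioi).1 h1
    refine h2.congr fun s => ?_
    simp [slope, h0]
  have hlim : Tendsto (fun s : ℝ => frameInner g p (q s) (s⁻¹ • chartField X p (u + s • v)) v)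
      (𝓝[>] 0) (𝓝 (g.inner p (linearPart X p v) v)) := by
    -- Continuity of the metric is known only for fixed pairs of vectors, so the moving vector is
    -- split into coordinates.
    have hcoord : ∀ i, Tendsto (fun s : ℝ => (s⁻¹ • chartField X p (u + s • v)) i) (𝓝[>] 0)
        (𝓝 (linearPart X p v i)) := fun i =>
      ((EuclideanSpace.proj (𝕜 := ℝ) i).continuous.tendsto _).comp hslope
    have hframe : ∀ w, Tendsto (fun s : ℝ => frameInner g p (q s) w v) (𝓝[>] 0)
        (𝓝 (frameInner g p p w v)) := fun w => (continuousAt_frameInner p w v).tendsto.comp hqt'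
    have h1 := ((hcoord 0).mul (hframe (EuclideanSpace.single 0 1))).add
      ((hcoord 1).mul (hframe (EuclideanSpace.single 1 1)))
    rw [← frameInner_eq_coordinates, frameInner_self] at h1
    refine h1.congr fun s => ?_
    rw [← frameInner_eq_coordinates]
  have hnegs : ∀ᶠ s in 𝓝[>] (0 : ℝ), c * frameInner g p (q s) (chartField X p (u + s • v)) v < 0 := by
    filter_upwards [(hlim.const_mul c).eventually_lt_const hneg, self_mem_nhdsWithin] with s hs hs0
    have h1 := frameInner_add_smul (g := g) p (q s) s⁻¹ 0 (chartField X p (u + s • v)) 0 v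
    rw [zero_smul, add_zero, zero_mul, add_zero] at h1
    rw [h1, mul_left_comm] at hs
    exact neg_of_mul_neg_right hs (inv_nonneg.2 (le_of_lt hs0))
  have htarget : ∀ᶠ s in 𝓝[≥] (0 : ℝ), u + s • v ∈ (extChartAt (𝓡∂ 2) p).target :=
    ht (extChartAt_target_mem_nhdsWithin p)
  have hminq : ∀ᶠ s in 𝓝[≥] (0 : ℝ), c * f p ≤ c * f (q s) := hqt hmin
  obtain ⟨δ₁, hδ₁, h1⟩ := mem_nhdsGT_iff_exists_Ioo_subset.1 hnegs
  obtain ⟨δ₂, hδ₂, h2⟩ := mem_nhdsGE_iff_exists_Ico_subset.1 (htarget.and hminq)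
  obtain ⟨δ, hδ, hδm⟩ := exists_between (lt_min (mem_Ioi.1 hδ₁) (mem_Ioi.1 hδ₂))
  have hδδ₁ := hδm.trans_le (min_le_left _ _)
  have hδδ₂ := hδm.trans_le (min_le_right _ _)
  have hd : ∀ s ∈ Icc 0 δ, HasDerivWithinAt (fun s => c * f (q s))
      (c * frameInner g p (q s) (chartField X p (u + s • v)) v) (Icc 0 δ) s := fun s hs => by
    obtain ⟨L, hL, hLv⟩ := hasFDerivWithinAt_potential_in_chart (g := g) hf hX
      (h2 ⟨hs.1, hs.2.trans_lt hδδ₂⟩).1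
    rw [← hLv]
    have hmaps : MapsTo (fun s : ℝ => u + s • v) (Icc 0 δ) (range (𝓡∂ 2)) :=
      fun t ht => hray t ht.1
    exact (hL.comp_hasDerivWithinAt s (hcd s).hasDerivWithinAt hmaps).const_mul c
  have hanti : StrictAntiOn (fun s => c * f (q s)) (Icc 0 δ) := by
    refine strictAntiOn_of_hasDerivWithinAt_neg (convex_Icc 0 δ)
      (fun s hs => (hd s hs).continuousWithinAt)
      (fun s hs => (hd s (interior_subset hs)).mono interior_subset) fun s hs => ?_
    rw [interior_Icc] at hs
    exact h1 ⟨hs.1, hs.2.trans hδδ₁⟩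
  have h3 := hanti (left_mem_Icc.2 hδ.le) (right_mem_Icc.2 hδ.le) hδ
  simp only [hq0] at h3
  exact h3.not_ge (h2 ⟨hδ.le, hδδ₂⟩).2

/-- A quadratic form is even, and one of `v`, `-v` points inward or along the boundary. -/
theorem inner_linearPart_nonneg (hf : ContMDiff (𝓡∂ 2) 𝓘(ℝ, ℝ) 2 f)
    (hX : ∀ (p : M) (v : TangentSpace (𝓡∂ 2) p),
      g.inner p (X p) v = mfderiv (𝓡∂ 2) 𝓘(ℝ, ℝ) f p v)
    {κ : SingularKind} {p : M} (hκ : IsSingularOfKind κ X p) {c : ℝ}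
    (hmin : IsLocalMin (fun q => c * f q) p) (v : EuclideanSpace ℝ (Fin 2)) :
    0 ≤ c * g.inner p (linearPart X p v) v := by
  rcases le_total 0 (v 0) with hv | hv
  · exact inner_linearPart_nonneg_of_inward hf hX hκ hmin hv
  · have hB : ∀ (B : EuclideanSpace ℝ (Fin 2) →L[ℝ] EuclideanSpace ℝ (Fin 2) →L[ℝ] ℝ)
        (L : EuclideanSpace ℝ (Fin 2) →L[ℝ] EuclideanSpace ℝ (Fin 2)),
        B (L (-v)) (-v) = B (L v) v := by simp
    have h := inner_linearPart_nonneg_of_inward hf hX hκ hmin (v := -v) (by simpa using hv)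
    exact h.trans_eq (congrArg (c * ·) (hB (g.inner p) (linearPart X p)))

theorem det_trace_nonneg_of_isLocalMin (hf : ContMDiff (𝓡∂ 2) 𝓘(ℝ, ℝ) 2 f)
    (hX : ∀ (p : M) (v : TangentSpace (𝓡∂ 2) p),
      g.inner p (X p) v = mfderiv (𝓡∂ 2) 𝓘(ℝ, ℝ) f p v)
    {κ : SingularKind} {p : M} (hκ : IsSingularOfKind κ X p) {c : ℝ}
    (hmin : IsLocalMin (fun q => c * f q) p) :
    0 ≤ c ^ 2 * LinearMap.det
      (linearPart X p : EuclideanSpace ℝ (Fin 2) →ₗ[ℝ] EuclideanSpace ℝ (Fin 2)) ∧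
    0 ≤ c * LinearMap.trace ℝ (EuclideanSpace ℝ (Fin 2))
      (linearPart X p : EuclideanSpace ℝ (Fin 2) →ₗ[ℝ] EuclideanSpace ℝ (Fin 2)) := by
  have h := det_trace_nonneg (g.inner p) (g.symm p) (g.pos p) (c • linearPart X p) fun v => by
    have hB : ∀ (B : EuclideanSpace ℝ (Fin 2) →L[ℝ] EuclideanSpace ℝ (Fin 2) →L[ℝ] ℝ)
        (L : EuclideanSpace ℝ (Fin 2) →L[ℝ] EuclideanSpace ℝ (Fin 2)),
        B ((c • L) v) v = c * B (L v) v := by simp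
    exact (inner_linearPart_nonneg hf hX hκ hmin v).trans_eq
      (hB (g.inner p) (linearPart X p)).symm
  rw [det_euclidean_eq, trace_euclidean_eq] at h ⊢
  simp only [smul_apply, PiLp.smul_apply, smul_eq_mul] at h
  constructor <;> linarith [h.1, h.2]

/-- A nondegenerate singular point at a local minimum of the potential is a source. -/
theorem IsSingularOfKind.eq_source_of_isLocalMin (hf : ContMDiff (𝓡∂ 2) 𝓘(ℝ, ℝ) 2 f)
    (hX : ∀ (p : M) (v : TangentSpace (𝓡∂ 2) p),
      g.inner p (X p) v = mfderiv (𝓡∂ 2) 𝓘(ℝ, ℝ) f p v)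
    {κ : SingularKind} {p : M} (hκ : IsSingularOfKind κ X p)
    (hmin : IsLocalMin (fun q => 1 * f q) p) : κ = .source := by
  obtain ⟨h1, h2⟩ := det_trace_nonneg_of_isLocalMin hf hX hκ hmin
  cases κ
  · have h3 : LinearMap.det (linearPart X p : EuclideanSpace ℝ (Fin 2) →ₗ[ℝ] _) < 0 := hκ.2
    linarith
  · rfl
  · have h3 : LinearMap.trace ℝ _ (linearPart X p : EuclideanSpace ℝ (Fin 2) →ₗ[ℝ] _) < 0 := hκ.2.2
    linarith

/-- A nondegenerate singular point at a local maximum of the potential is a sink. -/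
theorem IsSingularOfKind.eq_sink_of_isLocalMin_neg (hf : ContMDiff (𝓡∂ 2) 𝓘(ℝ, ℝ) 2 f)
    (hX : ∀ (p : M) (v : TangentSpace (𝓡∂ 2) p),
      g.inner p (X p) v = mfderiv (𝓡∂ 2) 𝓘(ℝ, ℝ) f p v)
    {κ : SingularKind} {p : M} (hκ : IsSingularOfKind κ X p)
    (hmin : IsLocalMin (fun q => -1 * f q) p) : κ = .sink := by
  obtain ⟨h1, h2⟩ := det_trace_nonneg_of_isLocalMin hf hX hκ hmin
  cases κ
  · have h3 : LinearMap.det (linearPart X p : EuclideanSpace ℝ (Fin 2) →ₗ[ℝ] _) < 0 := hκ.2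
    linarith
  · have h3 : 0 < LinearMap.trace ℝ _ (linearPart X p : EuclideanSpace ℝ (Fin 2) →ₗ[ℝ] _) := hκ.2.2
    linarith
  · rfl

end Surface

/-! ### The fourth and the fifth bifurcation on surfaces -/

section Surface

variable {M : Type*} [TopologicalSpace M]

/-- A local minimum in the half-plane is transported to the surface. -/
theorem IsOrbitEquiv.isLocalMin {S : (ℝ → M) → ℝ → Prop} {S' : (ℝ → ℝ × ℝ) → ℝ → Prop}
    {U : Set M} {V : Set (ℝ × ℝ)} {h : M → ℝ × ℝ} {k : ℝ × ℝ → M}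
    (hO : IsOrbitEquiv S U S' (V ∩ halfPlane) h k) (hU : IsOpen U) {u : M → ℝ} {q : ℝ × ℝ}
    (hq : q ∈ V ∩ halfPlane) {N : Set (ℝ × ℝ)} (hN : N ∈ 𝓝 q)
    (hu : ∀ p ∈ N ∩ halfPlane, u (k q) ≤ u (k p)) : IsLocalMin u (k q) := by
  have hkU : U ∈ 𝓝 (k q) := hU.mem_nhds (hO.mapsTo_inv hq)
  have hc : ContinuousAt h (k q) := hO.continuousOn.continuousAt hkU
  rw [ContinuousAt, hO.invOn.2 hq] at hc
  filter_upwards [hkU, hc hN] with x hxU hxN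
  have := hu (h x) ⟨hxN, (hO.mapsTo hxU).2⟩
  rwa [hO.invOn.1 hxU] at this

theorem isLocalExtr_of_isLocalMin_mul {u : M → ℝ} {c : ℝ} (hc : c = 1 ∨ c = -1) {p : M}
    (h : IsLocalMin (fun q => c * u q) p) : IsLocalExtr u p := by
  rcases hc with rfl | rfl
  · simp only [one_mul] at h
    exact Or.inl h
  · have h1 := h.neg
    simp only [neg_mul, one_mul, neg_neg] at h1
    exact Or.inr h1

variable [ChartedSpace (EuclideanHalfSpace 2) M] [IsManifold (𝓡∂ 2) ∞ M]
  {X X' : ∀ p : M, TangentSpace (𝓡∂ 2) p}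

theorem monotone_pullback_potential {f : M → ℝ}
    {g : Bundle.ContMDiffRiemannianMetric (𝓡∂ 2) 1 (EuclideanSpace ℝ (Fin 2))
      (fun p : M => TangentSpace (𝓡∂ 2) p)} (hf : ContMDiff (𝓡∂ 2) 𝓘(ℝ, ℝ) 2 f)
    (hX : ∀ (p : M) (v : TangentSpace (𝓡∂ 2) p),
      g.inner p (X p) v = mfderiv (𝓡∂ 2) 𝓘(ℝ, ℝ) f p v)
    {U : Set M} {Y : ℝ × ℝ → ℝ × ℝ} {B : Set (ℝ × ℝ)} {h : M → ℝ × ℝ} {k : ℝ × ℝ → M}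
    (hO : IsOrbitEquiv (IsSurfaceTrajectory X U) U (IsTrajectory Y B) B h k)
    (γ : ℝ → ℝ × ℝ) (T : ℝ) (hT : 0 ≤ T) (hγ : IsTrajectory Y B γ T) :
    f (k (γ 0)) ≤ f (k (γ T)) := by
  obtain ⟨δ, T', τ, hT', hδ, -, -, h0, h1, hτ⟩ := hO.map_trajectories_inv γ T hT hγ
  rw [hτ 0 (left_mem_Icc.2 hT), hτ T (right_mem_Icc.2 hT), h0, h1]
  exact hδ.monotoneOn_potential hf hX (left_mem_Icc.2 hT') (right_mem_Icc.2 hT') hT'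

/-- A bifurcation in which a unique source (`c = 1`) or sink (`c = -1`) disappears, while the only
singular point that appears is of the other kind, is impossible for gradient flows. -/
theorem not_isEffectOf_of_extremum_lost [CompactSpace M] {b : BoundaryBifurcation} {c : ℝ}
    {κ₀ : SingularKind} (hc : c = 1 ∧ κ₀ = .source ∨ c = -1 ∧ κ₀ = .sink) {q₀ q₁ : ℝ × ℝ}
    (hq₀ : q₀ ∈ singularPoints (b.normalForm (-1))) (hq₁ : singularPoints (b.normalForm 1) = {q₁})
    (hpos : 0 < q₁.2)
    (hmin : ∀ (V : Set (ℝ × ℝ)) (F : ℝ × ℝ → ℝ), IsOpen V → ContinuousOn F (V ∩ halfPlane) →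
      (∀ γ T, 0 ≤ T → IsTrajectory (b.normalForm (-1)) (V ∩ halfPlane) γ T → F (γ 0) ≤ F (γ T)) →
      q₀ ∈ V → ∃ N ∈ 𝓝 q₀, ∀ p ∈ N ∩ halfPlane, p ∈ V ∧ c * F q₀ ≤ c * F p)
    (hmax : ∀ (V : Set (ℝ × ℝ)) (F : ℝ × ℝ → ℝ), IsOpen V → ContinuousOn F (V ∩ halfPlane) →
      (∀ γ T, 0 ≤ T → IsTrajectory (b.normalForm 1) (V ∩ halfPlane) γ T → F (γ 0) ≤ F (γ T)) →
      q₁ ∈ V → ∃ N ∈ 𝓝 q₁, ∀ p ∈ N ∩ halfPlane, p ∈ V ∧ c * F p ≤ c * F q₁)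
    (hopt : IsOptimalGradient X) (hgrad : IsSurfaceGradient X') : ¬ IsEffectOf b X X' := by
  rintro ⟨U, hU, ⟨V, h, k, hV, hsV, hO⟩, ⟨V', h', k', hV', hsV', hO'⟩, σ, hσ⟩
  obtain ⟨⟨⟨f, g, hf, hX⟩, htan⟩, hnd, hsource, hsink⟩ := hopt
  obtain ⟨⟨f', g', hf', hX'⟩, htan'⟩ := hgrad
  have hc1 : c = 1 ∨ c = -1 := hc.imp And.left And.left
  have hunique : ∃! p, IsSingularOfKind κ₀ X p := by
    rcases hc with ⟨-, rfl⟩ | ⟨-, rfl⟩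
    exacts [hsource, hsink]
  have hq₀V : q₀ ∈ V ∩ halfPlane := ⟨hsV hq₀, hq₀.1⟩
  have hq₁s : q₁ ∈ singularPoints (b.normalForm 1) := by rw [hq₁]; rfl
  have hq₁V : q₁ ∈ V' ∩ halfPlane := ⟨hsV' hq₁s, hq₁s.1⟩
  have : Nonempty M := ⟨k q₀⟩
  -- The global minimum of `c f'` must be a zero of `X'`; neither position of it relative to `U` is
  -- possible.
  obtain ⟨m, hm⟩ : ∃ m, ∀ x, c * f' m ≤ c * f' x := by
    obtain ⟨m, -, hm⟩ := isCompact_univ.exists_isMinOn univ_nonempty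
      (continuous_const.mul hf'.continuous : Continuous fun x => c * f' x).continuousOn
    exact ⟨m, fun x => hm (mem_univ x)⟩
  have hzero : ∀ x, c * f' x ≤ c * f' m → X' x = 0 := fun x hx =>
    eq_zero_of_isLocalExtr hf' hX' htan' (isLocalExtr_of_isLocalMin_mul hc1
      (Eventually.of_forall fun y => hx.trans (hm y)))
  by_cases hmU : m ∈ U
  · have hsing : ∀ x ∈ U, X' x = 0 → h' x = q₁ := fun x hxU hx => by
      have : h' x ∈ singularPoints (b.normalForm 1) :=
        ⟨(hO'.mapsTo hxU).2, hO'.map_trajectories.singular_image (isSurfaceTrajectory_const hxU hx 1)⟩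
      rwa [hq₁] at this
    have hkq : k' q₁ = m := by rw [← hsing m hmU (hzero m le_rfl), hO'.invOn.1 hmU]
    -- The global minimum is also a local maximum, so nearby points are global minima too and hence
    -- zeros of `X'`, while `q₁` is the only zero available in `U`.
    obtain ⟨N, hN, hNle⟩ := hmax V' (fun p => f' (k' p)) hV'
      (hf'.continuous.comp_continuousOn hO'.continuousOn_inv)
      (monotone_pullback_potential hf' hX' hO') hq₁V.1
    have hN' : N ∩ {p | 0 < p.2} ∈ 𝓝[≠] q₁ := nhdsWithin_le_nhds
      (inter_mem hN ((isOpen_lt continuous_const continuous_snd).mem_nhds hpos))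
    obtain ⟨p, ⟨hpN, hp2⟩, hpne⟩ := Filter.nonempty_of_mem (inter_mem hN' self_mem_nhdsWithin)
    have hpH : p ∈ halfPlane := le_of_lt (show 0 < p.2 from hp2)
    obtain ⟨hpV, hple⟩ := hNle p ⟨hpN, hpH⟩
    simp only [hkq] at hple
    have := hsing _ (hO'.mapsTo_inv ⟨hpV, hpH⟩) (hzero _ hple)
    rw [hO'.invOn.2 ⟨hpV, hpH⟩] at this
    exact hpne this
  -- Nondegeneracy of `m` for `X'` is not assumed: it is inherited through `σ` from the
  -- nondegenerate zero `p` of `X`.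
  · obtain ⟨⟨p, hpU, hp0⟩, hpm⟩ := σ.surjective ⟨m, hmU, hzero m le_rfl⟩
    obtain ⟨κ, hκ⟩ := hnd p hp0
    have hκm : IsSingularOfKind κ X' m := by
      have := (hσ ⟨p, hpU, hp0⟩ κ).1 hκ
      rwa [hpm] at this
    obtain rfl : κ = κ₀ := by
      rcases hc with ⟨rfl, rfl⟩ | ⟨rfl, rfl⟩
      · exact hκm.eq_source_of_isLocalMin hf' hX' (Eventually.of_forall hm)
      · exact hκm.eq_sink_of_isLocalMin_neg hf' hX' (Eventually.of_forall hm)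
    obtain ⟨N, hN, hNle⟩ := hmin V (fun p => f (k p)) hV
      (hf.continuous.comp_continuousOn hO.continuousOn_inv)
      (monotone_pullback_potential hf hX hO) hq₀V.1
    -- The point of `U` matching `q₀` is thus a second zero of kind `κ₀`, distinct from `p ∉ U`.
    have hloc : IsLocalMin (fun x => c * f x) (k q₀) :=
      hO.isLocalMin hU hq₀V hN fun p hp => (hNle p hp).2
    obtain ⟨κ', hκ'⟩ := hnd (k q₀)
      (eq_zero_of_isLocalExtr hf hX htan (isLocalExtr_of_isLocalMin_mul hc1 hloc))
    obtain rfl : κ' = κ := by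
      rcases hc with ⟨rfl, rfl⟩ | ⟨rfl, rfl⟩
      · exact hκ'.eq_source_of_isLocalMin hf hX hloc
      · exact hκ'.eq_sink_of_isLocalMin_neg hf hX hloc
    exact hpU (hunique.unique hκ hκ' ▸ hO.mapsTo_inv hq₀V)

theorem not_isEffectOf_sourceSinkToSink [CompactSpace M] (hopt : IsOptimalGradient X)
    (hgrad : IsSurfaceGradient X') : ¬ IsEffectOf .sourceSinkToSink X X' := by
  refine not_isEffectOf_of_extremum_lost (c := 1) (q₀ := (1, 0)) (q₁ := (-1 / 2, √5 / 2))
    (Or.inl ⟨rfl, rfl⟩) ?_ ?_ (by positivity) ?_ ?_ hopt hgrad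
  · rw [normalForm_sourceSinkToSink, mem_singularPoints_quadraticField]
    norm_num
  · rw [normalForm_sourceSinkToSink, singularPoints_interior (by norm_num)]
  · intro V F hV hF hmono hq
    rw [normalForm_sourceSinkToSink] at hmono
    simpa only [one_mul] using boundary_source_locally_minimal hV hF hmono hq
  · intro V F hV hF hmono hq
    rw [normalForm_sourceSinkToSink] at hmono
    simpa only [one_mul] using interior_sink_locally_maximal hV hF hmono hq

theorem not_isEffectOf_sourceSinkToSource [CompactSpace M] (hopt : IsOptimalGradient X)
    (hgrad : IsSurfaceGradient X') : ¬ IsEffectOf .sourceSinkToSource X X' := by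
  refine not_isEffectOf_of_extremum_lost (c := -1) (q₀ := (-1, 0)) (q₁ := (1 / 2, √5 / 2))
    (Or.inr ⟨rfl, rfl⟩) ?_ ?_ (by positivity) ?_ ?_ hopt hgrad
  · rw [normalForm_sourceSinkToSource, mem_singularPoints_quadraticField]
    norm_num
  · rw [normalForm_sourceSinkToSource, singularPoints_interior (by norm_num), neg_neg]
  · intro V F hV hF hmono hq
    rw [normalForm_sourceSinkToSource, neg_neg] at hmono
    simpa only [neg_mul, one_mul, neg_le_neg_iff] using
      boundary_sink_locally_maximal hV hF hmono hq
  · intro V F hV hF hmono hq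
    rw [normalForm_sourceSinkToSource] at hmono
    simpa only [neg_mul, one_mul, neg_le_neg_iff] using
      interior_source_locally_minimal hV hF hmono hq

end Surface

end BoundaryFlows

open BoundaryFlows
theorem theorem3 :
    -- the families of fields that describe the five bifurcations show the five mergings
    (∀ b : BoundaryBifurcation, ShowsMerging b b.normalForm) ∧
    -- the first three are realized by explicit families of gradient flows
    BoundaryBifurcation.saddleSource.RealizedBy
      (fun a p => p.1 ^ 3 / 3 + a * p.1 + p.2 ^ 2 / 2) ∧
    BoundaryBifurcation.saddleSink.RealizedBy
      (fun a p => p.1 ^ 3 / 3 + a * p.1 - p.2 ^ 2 / 2) ∧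
    BoundaryBifurcation.doubleSaddle.RealizedBy
      (fun a p => p.1 ^ 3 / 3 + a * p.1 - p.1 * p.2 ^ 2) ∧
    BoundaryBifurcation.saddleSource.Realizable ∧
    BoundaryBifurcation.saddleSink.Realizable ∧
    BoundaryBifurcation.doubleSaddle.Realizable ∧
    -- the last two cannot be realized by gradient flows
    (∀ b ∈ ({.sourceSinkToSink, .sourceSinkToSource} : Set BoundaryBifurcation),
      ¬ b.Realizable ∧
      ConsistsOfLoops (b.normalForm 0) ∧
      -- nor is there, on a compact surface, a gradient flow that results from applying them to
      -- a gradient flow with a single source and a single sink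
      ∀ (M : Type*) [TopologicalSpace M] [T2Space M] [CompactSpace M]
        [ChartedSpace (EuclideanHalfSpace 2) M] [IsManifold (𝓡∂ 2) ∞ M]
        (X X' : ∀ p : M, TangentSpace (𝓡∂ 2) p),
        IsOptimalGradient X → IsSurfaceGradient X' → ¬ IsEffectOf b X X') := by
  refine ⟨showsMerging_normalForm, saddleSource_realizedBy, saddleSink_realizedBy,
    doubleSaddle_realizedBy, saddleSource_realizedBy.realizable,
    saddleSink_realizedBy.realizable, doubleSaddle_realizedBy.realizable, ?_⟩
  rintro b (rfl | rfl)
  · have h0 : BoundaryBifurcation.sourceSinkToSink.normalForm 0 = quadraticField 1 (-1) 2 0 0 :=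
      normalForm_sourceSinkToSink 0
    refine ⟨not_realizable_of_loops h0, h0 ▸ consistsOfLoops_quadraticField, ?_⟩
    intro M _ _ _ _ _ X X' hX hX'
    exact not_isEffectOf_sourceSinkToSink hX hX'
  · have h0 : BoundaryBifurcation.sourceSinkToSource.normalForm 0 =
        quadraticField 1 (-1) 2 0 0 := by
      rw [normalForm_sourceSinkToSource, neg_zero]
    refine ⟨not_realizable_of_loops h0, h0 ▸ consistsOfLoops_quadraticField, ?_⟩
    intro M _ _ _ _ _ X X' hX hX'
    exact not_isEffectOf_sourceSinkToSource hX hX'
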